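/- Let $U\subset\mathbb R$ be open, let $\mu$ be the Lebesgue measure on $U$, and let $\Pi(x,y)$ be a (complex-valued, measurable) kernel of an orthogonal projection operator $\Pi$ acting in $L^2(\mathbb R,\mu)$. Suppose that there are $\alpha\in(0,1/2)$, $\varepsilon>0$ and, for every $R>0$, a constant $C(R)>0$ such that 1. for all $x\ne y$ in $U$ with $|x|,|y|\ge R$, $$|\Pi(x,y)|\le C(R)\,\frac{|x/y|^{\alpha}+|y/x|^{\alpha}}{|x-y|};$$ 2. for all $y\in U$, $$\int_{|x|\le R}|\Pi(x,y)|^2\,d\mu(x)\le\frac{C(R)}{1+|y|^{1+\varepsilon}}.$$ (By 2, $\Pi$ is locally of trace class.) Let $\mathbb P_\Pi$ be the determinantal point process on $\mathbb R$ induced by $\Pi$, that is, the Borel probability measure on the space of locally finite configurations $X$ on $\mathbb R$ such that $$\mathbb E_{\mathbb P_\Pi}\prod_{x\in X}g(x)=\det\bigl(1+(g-1)\Pi\chi_B\bigr)$$ (Fredholm determinant) for every bounded measurable function $g$ for which $g-1$ is supported in a bounded Borel set $B$. Then $\mathbb P_\Pi$ is rigid: for every bounded Borel set $B\subset\mathbb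 R$, the number $\#_B$ of particles in $B$ is measurable with respect to the $\mathbb P_\Pi$-completion of the $\sigma$-algebra generated by the numbers $\#_A$ of particles in bounded Borel sets $A\subset\mathbb R\setminus B$. Moreover, for $T>R>0$ let $$\varphi^{(R,T)}(x)=1-\frac{\log^+(|x|-R)}{\log(T-R)}\ \text{ if }|x|\le T,\qquad \varphi^{(R,T)}(x)=0\ \text{ if }|x|>T,$$ where $\log^+t=\log\max(1,t)$ for $t\in\mathbb R$ (and the quotient is read as $0$ if $T-R=1$). Then the additive functional $S_{\varphi^{(R,T)}}(X)=\sum_{x\in X}\varphi^{(R,T)}(x)$ is square integrable with respect to $\mathbb P_\Pi$ for all $T>R>0$, and for every fixed $R>0$ $$\operatorname{Var}_{\mathbb P_\Pi}S_{\varphi^{(R,T)}}=O\!\left(\frac1{\log T}\right)\qquad(T\to\infty).$$ -/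

import Mathlib

open MeasureTheory ProbabilityTheory Filter Topology
open scoped ENNReal

noncomputable section

namespace PointProcess

section Multiplication

variable {M : Type*}

/-- `h` is a bounded measurable function. -/
def BoundedMeasurable [MeasurableSpace M] (h : M → ℂ) : Prop :=
  Measurable h ∧ ∃ c : ℝ, ∀ x, ‖h x‖ ≤ c

theorem BoundedMeasurable.memLp_top [MeasurableSpace M] {h : M → ℂ} (hh : BoundedMeasurable h)
    (μ : Measure M) : MemLp h ∞ μ := by
  obtain ⟨hm, c, hc⟩ := hh
  exact memLp_top_of_bound hm.aestronglyMeasurable c (Eventually.of_forall hc)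

theorem BoundedMeasurable.sub_one [MeasurableSpace M] {h : M → ℂ} (hh : BoundedMeasurable h) :
    BoundedMeasurable (fun x => h x - 1) := by
  obtain ⟨hm, c, hc⟩ := hh
  refine ⟨hm.sub_const 1, c + 1, fun x => (norm_sub_le _ _).trans ?_⟩
  simpa using hc x

theorem boundedMeasurable_indicator [MeasurableSpace M] {B : Set M} (hB : MeasurableSet B) :
    BoundedMeasurable (B.indicator (fun _ => (1 : ℂ))) := by
  refine ⟨measurable_const.indicator hB, 1, fun x => ?_⟩
  by_cases hx : x ∈ B <;> simp [hx]

/-- The operator of multiplication by the bounded measurable function `h` on `L²(μ)`. -/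
def mulOp [MeasurableSpace M] (μ : Measure M) (h : M → ℂ) (hh : BoundedMeasurable h) :
    Lp ℂ 2 μ →L[ℂ] Lp ℂ 2 μ :=
  (ContinuousLinearMap.mul ℂ ℂ).holderL μ ∞ 2 2 ((hh.memLp_top μ).toLp h)

theorem mulOp_apply_ae [MeasurableSpace M] (μ : Measure M) (h : M → ℂ)
    (hh : BoundedMeasurable h) (f : Lp ℂ 2 μ) : mulOp μ h hh f =ᵐ[μ] fun x => h x * f x := by
  have h1 : mulOp μ h hh f =ᵐ[μ] fun x => ((hh.memLp_top μ).toLp h) x * f x :=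
    ContinuousLinearMap.coeFn_holder (ContinuousLinearMap.mul ℂ ℂ) _ f
  filter_upwards [h1, (hh.memLp_top μ).coeFn_toLp] with x hx hx'
  rw [hx, hx']

end Multiplication

section Configurations

variable (M : Type*) [PseudoMetricSpace M]

/-- A configuration on `M`: finitely many particles in every bounded set. The particles are
counted with multiplicity; `mult x` is the number of particles at `x`, so that the configuration
is the purely atomic Radon measure `∑ x, mult x • δ_x`. -/
structure Configuration where
  mult : M → ℕ
  finite_of_isBounded : ∀ B : Set M, Bornology.IsBounded B → (B ∩ Function.support mult).Finite

end Configurations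

variable {M : Type*} [PseudoMetricSpace M]

/-- The number of particles of `X` in the bounded set `B`. -/
def count (B : Set M) (X : Configuration M) : ℕ := ∑ᶠ x ∈ B, X.mult x

/-- The additive functional `∑_{x ∈ X} f x` (particles counted with multiplicity), for `f` of
bounded support. -/
def additive (f : M → ℝ) (X : Configuration M) : ℝ := ∑ᶠ x, (X.mult x : ℝ) * f x

/-- The multiplicative functional `∏_{x ∈ X} g x` (particles counted with multiplicity), for `g`
equal to `1` off a bounded set. -/
def multiplicative (g : M → ℂ) (X : Configuration M) : ℂ := ∏ᶠ x, g x ^ X.mult x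

/-- The σ-algebra generated by the random variables `count B`, for `B` bounded Borel and
contained in `C`. -/
@[reducible] def countSigma [MeasurableSpace M] (C : Set M) : MeasurableSpace (Configuration M) :=
  ⨆ (B : Set M) (_ : Bornology.IsBounded B ∧ MeasurableSet B ∧ B ⊆ C),
    MeasurableSpace.comap (count B) ⊤

/-- The Borel σ-algebra on the space of configurations, generated by all particle counts. -/
instance [MeasurableSpace M] : MeasurableSpace (Configuration M) := countSigma Set.univ

/-- The completion of `countSigma C` with respect to `P`: all sets that differ from a set in
`countSigma C` by a `P`-null set. -/
@[reducible] def completedCountSigma [MeasurableSpace M] (P : Measure (Configuration M)) (C : Set M) :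
    MeasurableSpace (Configuration M) :=
  eventuallyMeasurableSpace (countSigma C) (ae P)

/-- `P` is rigid: for every bounded Borel set `B`, the number of particles in `B` is measurable
with respect to the `P`-completion of the σ-algebra of the particles outside `B`. -/
def IsRigid [MeasurableSpace M] (P : Measure (Configuration M)) : Prop :=
  ∀ B : Set M, Bornology.IsBounded B → MeasurableSet B →
    Measurable[completedCountSigma P Bᶜ] (count B)

open Classical in
/-- `A` is of trace class and `d` is the Fredholm determinant
`det (1 + A) = ∑ₙ tr (Λⁿ A)`. In an orthonormal basis `e`, the trace of `Λⁿ A` is the sum over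
the `n`-element sets `s` of indices of the principal minors `det (⟪e i, A e j⟫)_{i, j ∈ s}`, since
the exterior products of the `e i`, `i ∈ s`, form an orthonormal basis of the exterior power.
If `A` is of trace class, the sum over all finite `s` converges absolutely to `det (1 + A)` in
every orthonormal basis; conversely, its (unconditional) convergence in every orthonormal basis
contains the absolute convergence of `∑ i, ⟪e i, A e i⟫` in every orthonormal basis, which means
that `A` is of trace class. -/
def HasFredholmDet {H : Type} [NormedAddCommGroup H] [InnerProductSpace ℂ H]
    (A : H →L[ℂ] H) (d : ℂ) : Prop :=
  ∀ (ι : Type) (e : HilbertBasis ι ℂ H),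
    HasSum (fun s : Finset ι =>
      (Matrix.of fun i j : {i // i ∈ s} => inner ℂ (e i) (A (e j))).det) d

/-- `P` is the determinantal point process induced by the operator `Q` on `L²(μ)`: for every
bounded measurable `g` such that `g - 1` is supported in a bounded set `B`,
`E_P ∏_{x ∈ X} g x = det (1 + (g - 1) Q χ_B)`. -/
def IsDeterminantal {M : Type} [PseudoMetricSpace M] [MeasurableSpace M] (μ : Measure M)
    (Q : Lp ℂ 2 μ →L[ℂ] Lp ℂ 2 μ) (P : Measure (Configuration M)) : Prop :=
  ∀ (g : M → ℂ) (B : Set M) (hg : BoundedMeasurable g) (hB : MeasurableSet B),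
    Bornology.IsBounded B → (∀ x, x ∉ B → g x = 1) →
      Integrable (multiplicative g) P ∧
      HasFredholmDet
        (mulOp μ (fun x => g x - 1) hg.sub_one ∘L Q ∘L
          mulOp μ (B.indicator fun _ => (1 : ℂ)) (boundedMeasurable_indicator hB))
        (∫ X, multiplicative g X ∂P)

/-- `Q` is the integral operator on `L²(μ)` with the kernel `K`. -/
def IsKernelOf [MeasurableSpace M] (μ : Measure M) (K : M → M → ℂ)
    (Q : Lp ℂ 2 μ →L[ℂ] Lp ℂ 2 μ) : Prop :=
  AEStronglyMeasurable (Function.uncurry K) (μ.prod μ) ∧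
  ∀ f : Lp ℂ 2 μ, ∀ᵐ x ∂μ,
    Integrable (fun y => K x y * f y) μ ∧ Q f x = ∫ y, K x y * f y ∂μ

/-- The logarithmic cutoff: `1 - log⁺ (|x| - R) / log (T - R)` for `|x| ≤ T`, and `0` for
`|x| > T`, where `log⁺ t = log (max 1 t)` for every real `t`. -/
def logCutoff (R T x : ℝ) : ℝ :=
  if |x| ≤ T then 1 - Real.log (max 1 (|x| - R)) / Real.log (T - R) else 0

end PointProcess

end

namespace PointProcess

/-! Rigidity comes from the Ghosh–Peres principle. Suppose that functions `f n` of bounded support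
equal 1 on `B` and that the variances of their additive functionals tend to 0 fast enough to be
summable. Then each functional minus its mean tends to 0 almost surely. Since `f n` is 1 on `B`, the
functional is `count B` plus a functional of the particles outside `B`, so `count B` is almost
surely a limit of outside functionals (`isRigid_of_tendsto_variance`). Everything thus reduces to
the variance of the logarithmic cutoffs.

Let `F` be multiplication by `f`, with values in `[0, 1]` and bounded support. The key formula is 2
Var S_f = ‖FQ - QF‖², in Hilbert–Schmidt norm (`IsDeterminantal.variance_additive`). The process is
known only through E ∏ (1 + t f) = det (1 + t FQχ). Both sides are expanded to second order in `t`,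
with error O(t³) on (0, 1], and coefficients are compared: E S_f = tr FQχ and E (S_f² - S_{f²}) =
(tr FQχ)² - tr (FQχ)². The same for f² gives E S_{f²} = ‖FQ‖², and the formula follows from Q² = Q =
Q*. Every trace is rewritten as an inner product of Hilbert–Schmidt operators, so no theory of
trace-class operators is needed.

The squared norm is controlled by energy integrals of |f(x) - f(y)|² |K(x, y)|². For the cutoff, put
L = log (T - R). When |x| ≤ R the cutoff is 1 at x, and condition 2 gives O(1/L²). When |x|, |y| >
R, with |x| ≤ |y| by symmetry, condition 1 bounds the integral over y by a constant times 1/(L²|x|);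
this uses α < 1/2. Integrating over R < |x| < T gives O(log (T/R)/L²), hence O(1/log T). -/

theorem enorm_add_add_sq_le {E : Type*} [SeminormedAddCommGroup E] (x y z : E) :
    ‖x + y + z‖ₑ ^ 2 ≤ 3 * (‖x‖ₑ ^ 2 + ‖y‖ₑ ^ 2 + ‖z‖ₑ ^ 2) := by
  simp only [← ofReal_norm]
  rw [← ENNReal.ofReal_pow (norm_nonneg _), ← ENNReal.ofReal_pow (norm_nonneg _),
    ← ENNReal.ofReal_pow (norm_nonneg _), ← ENNReal.ofReal_pow (norm_nonneg _),
    ← ENNReal.ofReal_add (by positivity) (by positivity),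
    ← ENNReal.ofReal_add (by positivity) (by positivity),
    show (3 : ℝ≥0∞) = ENNReal.ofReal 3 by simp, ← ENNReal.ofReal_mul (by norm_num)]
  apply ENNReal.ofReal_le_ofReal
  have h : ‖x + y + z‖ ≤ ‖x‖ + ‖y‖ + ‖z‖ := norm_add₃_le
  calc ‖x + y + z‖ ^ 2 ≤ (‖x‖ + ‖y‖ + ‖z‖) ^ 2 := by gcongr
    _ ≤ _ := by nlinarith [sq_nonneg (‖x‖ - ‖y‖), sq_nonneg (‖y‖ - ‖z‖), sq_nonneg (‖x‖ - ‖z‖)]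

/-! ### Hilbert–Schmidt norm and inner product in a fixed orthonormal basis. -/

section HilbertSchmidt

variable {ι H : Type*} [NormedAddCommGroup H] [InnerProductSpace ℂ H]

/-- The square of the Hilbert–Schmidt norm of `A`, computed in the orthonormal basis `e`. -/
noncomputable def hsNormSq (e : HilbertBasis ι ℂ H) (A : H →L[ℂ] H) : ℝ≥0∞ :=
  ∑' i, ‖A (e i)‖ₑ ^ 2

theorem enorm_sq_eq_tsum_inner (e : HilbertBasis ι ℂ H) (x : H) :
    ‖x‖ₑ ^ 2 = ∑' j, ‖inner ℂ (e j) x‖ₑ ^ 2 := by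
  have h := e.hasSum_inner_mul_inner x x
  have h1 : ∀ j, inner ℂ x (e j) * inner ℂ (e j) x = ((‖inner ℂ (e j) x‖ ^ 2 : ℝ) : ℂ) := by
    intro j
    rw [← inner_conj_symm x (e j), Complex.conj_mul']
    push_cast; rfl
  have h2 : inner ℂ x x = ((‖x‖ ^ 2 : ℝ) : ℂ) := by
    rw [inner_self_eq_norm_sq_to_K]; push_cast; rfl
  simp only [h1, h2] at h
  have h3 : HasSum (fun j => ‖inner ℂ (e j) x‖ ^ 2) (‖x‖ ^ 2) := by exact_mod_cast h
  have h4 := ENNReal.ofReal_tsum_of_nonneg (fun j => sq_nonneg ‖inner ℂ (e j) x‖) h3.summable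
  rw [h3.tsum_eq] at h4
  simpa only [ENNReal.ofReal_pow (norm_nonneg _), ofReal_norm] using h4

theorem hsNormSq_eq_tsum_inner (e : HilbertBasis ι ℂ H) (A : H →L[ℂ] H) :
    hsNormSq e A = ∑' p : ι × ι, ‖inner ℂ (e p.2) (A (e p.1))‖ₑ ^ 2 := by
  rw [ENNReal.tsum_prod (f := fun i j => ‖inner ℂ (e j) (A (e i))‖ₑ ^ 2)]
  exact tsum_congr fun i => enorm_sq_eq_tsum_inner e _

theorem hsNormSq_adjoint [CompleteSpace H] (e : HilbertBasis ι ℂ H) (A : H →L[ℂ] H) :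
    hsNormSq e (ContinuousLinearMap.adjoint A) = hsNormSq e A := by
  rw [hsNormSq_eq_tsum_inner, hsNormSq_eq_tsum_inner, ← (Equiv.prodComm ι ι).tsum_eq]
  refine tsum_congr fun p => ?_
  simp only [Equiv.prodComm_apply, Prod.swap, ContinuousLinearMap.adjoint_inner_right]
  rw [← inner_conj_symm, RCLike.enorm_conj]

theorem hsNormSq_neg (e : HilbertBasis ι ℂ H) (A : H →L[ℂ] H) :
    hsNormSq e (-A) = hsNormSq e A := by
  simp [hsNormSq]

theorem hsNormSq_add_add_le (e : HilbertBasis ι ℂ H) (A B C : H →L[ℂ] H) :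
    hsNormSq e (A + B + C) ≤ 3 * (hsNormSq e A + hsNormSq e B + hsNormSq e C) := by
  unfold hsNormSq
  rw [← ENNReal.tsum_add, ← ENNReal.tsum_add, ← ENNReal.tsum_mul_left]
  exact ENNReal.tsum_le_tsum fun i => enorm_add_add_sq_le _ _ _

theorem hsNormSq_comp_le (e : HilbertBasis ι ℂ H) (B A : H →L[ℂ] H) :
    hsNormSq e (B ∘L A) ≤ ‖B‖ₑ ^ 2 * hsNormSq e A := by
  unfold hsNormSq
  rw [← ENNReal.tsum_mul_left]
  refine ENNReal.tsum_le_tsum fun i => ?_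
  rw [← mul_pow]
  gcongr
  exact B.le_opENorm _

theorem hsNormSq_comp_ne_top (e : HilbertBasis ι ℂ H) (B : H →L[ℂ] H) {A : H →L[ℂ] H}
    (hA : hsNormSq e A ≠ ∞) : hsNormSq e (B ∘L A) ≠ ∞ :=
  ne_top_of_le_ne_top (ENNReal.mul_ne_top (by simp) hA) (hsNormSq_comp_le e B A)

theorem hsNormSq_comp_ne_top' [CompleteSpace H] (e : HilbertBasis ι ℂ H) {A : H →L[ℂ] H}
    (B : H →L[ℂ] H) (hA : hsNormSq e A ≠ ∞) : hsNormSq e (A ∘L B) ≠ ∞ := by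
  rw [← hsNormSq_adjoint, ContinuousLinearMap.adjoint_comp]
  exact hsNormSq_comp_ne_top e _ (by rwa [hsNormSq_adjoint])

theorem summable_norm_sq_of_hsNormSq_ne_top (e : HilbertBasis ι ℂ H) {A : H →L[ℂ] H}
    (hA : hsNormSq e A ≠ ∞) : Summable fun i => ‖A (e i)‖ ^ 2 := by
  have := ENNReal.summable_toReal hA
  simpa using this

theorem hsNormSq_toReal (e : HilbertBasis ι ℂ H) (A : H →L[ℂ] H) :
    (hsNormSq e A).toReal = ∑' i, ‖A (e i)‖ ^ 2 := by
  rw [hsNormSq, ENNReal.tsum_toReal_eq (by simp)]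
  simp

theorem summable_inner_sq_of_hsNormSq_ne_top (e : HilbertBasis ι ℂ H) {A : H →L[ℂ] H}
    (hA : hsNormSq e A ≠ ∞) : Summable fun p : ι × ι => ‖inner ℂ (e p.2) (A (e p.1))‖ ^ 2 := by
  rw [hsNormSq_eq_tsum_inner] at hA
  have := ENNReal.summable_toReal hA
  simpa using this

/-- The Hilbert–Schmidt inner product of `S` and `T`, computed in the orthonormal basis `e`. -/
noncomputable def hsInner (e : HilbertBasis ι ℂ H) (S T : H →L[ℂ] H) : ℂ :=
  ∑' i, inner ℂ (S (e i)) (T (e i))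

theorem summable_inner_of_hsNormSq_ne_top (e : HilbertBasis ι ℂ H) {S T : H →L[ℂ] H}
    (hS : hsNormSq e S ≠ ∞) (hT : hsNormSq e T ≠ ∞) :
    Summable fun i => inner ℂ (S (e i)) (T (e i)) := by
  refine Summable.of_norm_bounded ((summable_norm_sq_of_hsNormSq_ne_top e hS).add
    (summable_norm_sq_of_hsNormSq_ne_top e hT)) fun i => (norm_inner_le_norm _ _).trans ?_
  nlinarith [sq_nonneg (‖S (e i)‖ - ‖T (e i)‖), sq_nonneg (‖S (e i)‖ + ‖T (e i)‖)]

theorem hasSum_hsInner (e : HilbertBasis ι ℂ H) {S T : H →L[ℂ] H}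
    (hS : hsNormSq e S ≠ ∞) (hT : hsNormSq e T ≠ ∞) :
    HasSum (fun p : ι × ι => inner ℂ (S (e p.1)) (e p.2) * inner ℂ (e p.2) (T (e p.1)))
      (hsInner e S T) := by
  have hs : Summable fun p : ι × ι =>
      inner ℂ (S (e p.1)) (e p.2) * inner ℂ (e p.2) (T (e p.1)) := by
    refine Summable.of_norm_bounded ((summable_inner_sq_of_hsNormSq_ne_top e hS).add
      (summable_inner_sq_of_hsNormSq_ne_top e hT)) fun p => ?_
    rw [norm_mul, norm_inner_symm]
    nlinarith [sq_nonneg (‖inner ℂ (e p.2) (S (e p.1))‖ - ‖inner ℂ (e p.2) (T (e p.1))‖),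
      sq_nonneg (‖inner ℂ (e p.2) (S (e p.1))‖ + ‖inner ℂ (e p.2) (T (e p.1))‖)]
  have h : HasSum (fun i => inner ℂ (S (e i)) (T (e i))) _ :=
    hs.hasSum.prod_fiberwise fun i => e.hasSum_inner_mul_inner (S (e i)) (T (e i))
  have h2 : hsInner e S T = _ := h.tsum_eq
  rw [h2]
  exact hs.hasSum

/-- This is the cyclicity tr (S*T) = tr (TS*): the double series of matrix coefficients converges
absolutely, and its two indices may be exchanged. It is the only form of cyclicity used. -/
theorem hsInner_adjoint [CompleteSpace H] (e : HilbertBasis ι ℂ H) {S T : H →L[ℂ] H}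
    (hS : hsNormSq e S ≠ ∞) (hT : hsNormSq e T ≠ ∞) :
    hsInner e (ContinuousLinearMap.adjoint T) (ContinuousLinearMap.adjoint S) = hsInner e S T := by
  refine (hasSum_hsInner e (by rwa [hsNormSq_adjoint]) (by rwa [hsNormSq_adjoint])).unique ?_
  rw [← (Equiv.prodComm ι ι).hasSum_iff]
  refine (hasSum_hsInner e hS hT).congr_fun fun p => ?_
  simp only [Function.comp, Equiv.prodComm_apply, Prod.swap,
    ContinuousLinearMap.adjoint_inner_right, ContinuousLinearMap.adjoint_inner_left]
  ring

theorem hsInner_comp_right [CompleteSpace H] (e : HilbertBasis ι ℂ H) (S B T : H →L[ℂ] H) :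
    hsInner e S (B ∘L T) = hsInner e (ContinuousLinearMap.adjoint B ∘L S) T := by
  refine tsum_congr fun i => ?_
  simp [ContinuousLinearMap.adjoint_inner_left]

theorem hsInner_self (e : HilbertBasis ι ℂ H) (S : H →L[ℂ] H) :
    hsInner e S S = (∑' i, ‖S (e i)‖ ^ 2 : ℝ) := by
  push_cast
  refine tsum_congr fun i => ?_
  rw [inner_self_eq_norm_sq_to_K]; rfl

theorem hsNormSq_sub_toReal (e : HilbertBasis ι ℂ H) {S T : H →L[ℂ] H}
    (hS : hsNormSq e S ≠ ∞) (hT : hsNormSq e T ≠ ∞) :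
    (hsNormSq e (S - T)).toReal =
      (hsNormSq e S).toReal + (hsNormSq e T).toReal - 2 * (hsInner e S T).re := by
  rw [hsNormSq_toReal, hsNormSq_toReal, hsNormSq_toReal]
  have h1 := (summable_norm_sq_of_hsNormSq_ne_top e hS).hasSum
  have h2 := (summable_norm_sq_of_hsNormSq_ne_top e hT).hasSum
  have h3 := Complex.hasSum_re (summable_inner_of_hsNormSq_ne_top e hS hT).hasSum
  have h4 := (h1.add h2).sub (h3.mul_left 2)
  refine HasSum.tsum_eq (h4.congr_fun fun i => ?_)
  rw [sub_apply, norm_sub_sq (𝕜 := ℂ)]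
  simp only [RCLike.re_to_complex]
  ring

end HilbertSchmidt

/-! ### Principal minors and the coefficients of the Fredholm determinant. -/

section Minors

variable {ι : Type*}

open Classical in
/-- The principal minor of the infinite matrix `M` with rows and columns in `s`. -/
noncomputable def principalMinor (M : ι → ι → ℂ) (s : Finset ι) : ℂ :=
  (Matrix.of fun i j : {i // i ∈ s} => M i j).det

theorem principalMinor_empty (M : ι → ι → ℂ) : principalMinor M ∅ = 1 := by
  simp [principalMinor]

theorem principalMinor_singleton (M : ι → ι → ℂ) (i : ι) : principalMinor M {i} = M i i := by
  have : Subsingleton {j // j ∈ ({i} : Finset ι)} :=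
    ⟨fun j k => Subtype.ext ((Finset.mem_singleton.1 j.2).trans (Finset.mem_singleton.1 k.2).symm)⟩
  have h := Matrix.det_eq_elem_of_subsingleton
    (Matrix.of fun k l : {j // j ∈ ({i} : Finset ι)} => M k l) ⟨i, Finset.mem_singleton_self i⟩
  unfold principalMinor
  convert h
  rfl

open Classical in
theorem principalMinor_pair (M : ι → ι → ℂ) {i j : ι} (hij : i ≠ j) :
    principalMinor M {i, j} = M i i * M j j - M i j * M j i := by
  let v : Fin 2 → {k // k ∈ ({i, j} : Finset ι)} := ![⟨i, by simp⟩, ⟨j, by simp⟩]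
  have hv : Function.Bijective v := by
    constructor
    · intro a b hab
      fin_cases a <;> fin_cases b <;> simp_all [v, Subtype.ext_iff]
    · rintro ⟨k, hk⟩
      rcases Finset.mem_insert.1 hk with h | h
      · exact ⟨0, Subtype.ext h.symm⟩
      · exact ⟨1, Subtype.ext (Finset.mem_singleton.1 h).symm⟩
  have h := Matrix.det_submatrix_equiv_self (Equiv.ofBijective v hv)
    (Matrix.of fun k l : {k // k ∈ ({i, j} : Finset ι)} => M k l)
  rw [Matrix.det_fin_two] at h
  rw [principalMinor, ← h]
  simp [v]

theorem principalMinor_smul (t : ℂ) (M : ι → ι → ℂ) (s : Finset ι) :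
    principalMinor (fun i j => t * M i j) s = t ^ s.card * principalMinor M s := by
  classical
  have h := Matrix.det_smul (Matrix.of fun i j : {i // i ∈ s} => M i j) t
  rw [Fintype.card_coe] at h
  unfold principalMinor
  convert h using 2
  ext i j
  simp

theorem sum_principalMinor_card_one (M : ι → ι → ℂ) (F : Finset ι) :
    ∑ s ∈ F.powersetCard 1, principalMinor M s = ∑ i ∈ F, M i i := by
  rw [Finset.powersetCard_one, Finset.sum_map]
  exact Finset.sum_congr rfl fun i _ => principalMinor_singleton M i

/-- This is 2e₂ = (tr M)² - tr M² for a finite truncation. Adding an index `a` to `F` adds exactly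
the minors of the pairs `{a, i}`. -/
theorem sum_principalMinor_card_two (M : ι → ι → ℂ) (F : Finset ι) :
    2 * ∑ s ∈ F.powersetCard 2, principalMinor M s =
      (∑ i ∈ F, M i i) ^ 2 - ∑ p ∈ F ×ˢ F, M p.1 p.2 * M p.2 p.1 := by
  classical
  rw [Finset.sum_product]
  induction F using Finset.induction_on with
  | empty =>
    rw [Finset.powersetCard_eq_empty.2 (by simp)]
    simp
  | insert a F ha ih =>
    have hdisj : Disjoint (Finset.powersetCard 2 F)
        (Finset.image (insert a) (Finset.powersetCard 1 F)) := by
      rw [Finset.disjoint_left]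
      intro s hs hs'
      obtain ⟨u, -, rfl⟩ := Finset.mem_image.1 hs'
      exact ha ((Finset.mem_powersetCard.1 hs).1 (Finset.mem_insert_self a u))
    have himage : ∑ s ∈ Finset.image (insert a) (Finset.powersetCard 1 F), principalMinor M s =
        ∑ i ∈ F, (M a a * M i i - M a i * M i a) := by
      rw [Finset.sum_image]
      · rw [Finset.powersetCard_one, Finset.sum_map]
        refine Finset.sum_congr rfl fun i hi => ?_
        exact principalMinor_pair M fun h => ha (h ▸ hi)
      · intro s hs u hu hsu
        have h1 : a ∉ s := fun h => ha ((Finset.mem_powersetCard.1 hs).1 h)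
        have h2 : a ∉ u := fun h => ha ((Finset.mem_powersetCard.1 hu).1 h)
        have h3 : (insert a s).erase a = (insert a u).erase a := congrArg (Finset.erase · a) hsu
        rwa [Finset.erase_insert h1, Finset.erase_insert h2] at h3
    rw [Finset.powersetCard_succ_insert ha, Finset.sum_union hdisj, mul_add, ih, himage,
      Finset.sum_insert ha, Finset.sum_insert ha, Finset.sum_insert ha]
    have h : ∑ x ∈ F, ∑ y ∈ insert a F, M x y * M y x =
        ∑ x ∈ F, M a x * M x a + ∑ x ∈ F, ∑ y ∈ F, M x y * M y x := by
      rw [← Finset.sum_add_distrib]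
      refine Finset.sum_congr rfl fun x _ => ?_
      rw [Finset.sum_insert ha, mul_comm]
    rw [h, Finset.sum_sub_distrib, ← Finset.mul_sum]
    ring

/-- The `k`-th coefficient of the expansion of `det (1 + t M)` in powers of `t`. -/
noncomputable def minorCoeff (M : ι → ι → ℂ) (k : ℕ) : ℂ :=
  ∑' s : Finset ι, if s.card = k then principalMinor M s else 0

theorem hasSum_minorCoeff {M : ι → ι → ℂ} (hM : Summable (principalMinor M)) (k : ℕ) :
    HasSum (fun s : Finset ι => if s.card = k then principalMinor M s else 0)
      (minorCoeff M k) := by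
  refine Summable.hasSum (Summable.of_norm_bounded hM.norm fun s => ?_)
  split_ifs <;> simp

/-- The powersets of finite index sets are cofinal among finite families of finite sets, so
identities between finite truncations pass to the limit. -/
theorem tendsto_sum_powersetCard_principalMinor {M : ι → ι → ℂ}
    (hM : Summable (principalMinor M)) (k : ℕ) :
    Tendsto (fun F : Finset ι => ∑ s ∈ F.powersetCard k, principalMinor M s) atTop
      (𝓝 (minorCoeff M k)) := by
  have h : Tendsto (fun A : Finset (Finset ι) => ∑ s ∈ A, if s.card = k then principalMinor M s
    else 0) atTop (𝓝 (minorCoeff M k)) := hasSum_minorCoeff hM k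
  refine (h.comp tendsto_finset_powerset_atTop_atTop).congr fun F => ?_
  classical
  simp only [Function.comp]
  rw [← Finset.sum_filter, Finset.powersetCard_eq_filter]

theorem hasSum_diag_minorCoeff {M : ι → ι → ℂ} (hM : Summable (principalMinor M)) :
    HasSum (fun i => M i i) (minorCoeff M 1) :=
  (tendsto_sum_powersetCard_principalMinor hM 1).congr fun F => sum_principalMinor_card_one M F

theorem two_mul_minorCoeff_two {M : ι → ι → ℂ} (hM : Summable (principalMinor M)) {q : ℂ}
    (hq : HasSum (fun p : ι × ι => M p.1 p.2 * M p.2 p.1) q) :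
    2 * minorCoeff M 2 = minorCoeff M 1 ^ 2 - q := by
  refine tendsto_nhds_unique ((tendsto_sum_powersetCard_principalMinor hM 2).const_mul 2) ?_
  have h1 : Tendsto (fun F : Finset ι => ∑ i ∈ F, M i i) atTop (𝓝 (minorCoeff M 1)) :=
    hasSum_diag_minorCoeff hM
  have h2 : Tendsto (fun F : Finset (ι × ι) => ∑ p ∈ F, M p.1 p.2 * M p.2 p.1) atTop (𝓝 q) := hq
  -- Square index sets are cofinal, so the double series may be summed along them.
  have h3 : Tendsto (fun F : Finset ι => F ×ˢ F) atTop atTop := by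
    have := Filter.tendsto_finsetProd_atTop (ι := ι) (ι' := ι)
    rw [← prod_atTop_atTop_eq] at this
    exact this.comp (tendsto_id.prodMk tendsto_id)
  exact ((h1.pow 2).sub (h2.comp h3)).congr fun F => (sum_principalMinor_card_two M F).symm

theorem minorCoeff_zero {M : ι → ι → ℂ} (hM : Summable (principalMinor M)) :
    minorCoeff M 0 = 1 := by
  refine tendsto_nhds_unique (tendsto_sum_powersetCard_principalMinor hM 0) ?_
  simp [principalMinor_empty]

/-- Only index sets with at least three elements remain, and there t^|s| ≤ t³. -/
theorem norm_det_sub_expansion_le {M : ι → ι → ℂ} (hM : Summable (principalMinor M)) {t : ℝ}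
    (ht0 : 0 ≤ t) (ht1 : t ≤ 1) {d : ℂ}
    (hd : HasSum (principalMinor fun i j => (t : ℂ) * M i j) d) :
    ‖d - 1 - t * minorCoeff M 1 - t ^ 2 * minorCoeff M 2‖ ≤
      t ^ 3 * ∑' s, ‖principalMinor M s‖ := by
  have h0 := hasSum_minorCoeff hM 0
  rw [minorCoeff_zero hM] at h0
  have h1 := (hasSum_minorCoeff hM 1).mul_left (t : ℂ)
  have h2 := (hasSum_minorCoeff hM 2).mul_left ((t : ℂ) ^ 2)
  have h := ((hd.sub h0).sub h1).sub h2
  rw [← h.tsum_eq, ← tsum_mul_left]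
  refine tsum_of_norm_bounded (hM.norm.mul_left (t ^ 3)).hasSum fun s => ?_
  rw [principalMinor_smul]
  rcases Nat.lt_or_ge s.card 3 with hs | hs
  · have : 0 ≤ t ^ 3 * ‖principalMinor M s‖ := by positivity
    interval_cases s.card <;> simpa using this
  · rw [if_neg (by omega), if_neg (by omega), if_neg (by omega)]
    simp only [sub_zero, mul_zero, norm_mul, norm_pow, Complex.norm_real, Real.norm_eq_abs,
      abs_of_nonneg ht0]
    exact mul_le_mul_of_nonneg_right (pow_le_pow_of_le_one ht0 ht1 hs) (norm_nonneg _)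

end Minors

/-! ### Comparison of second-order expansions. -/

theorem HasFredholmDet.hasSum_principalMinor {H : Type} [NormedAddCommGroup H]
    [InnerProductSpace ℂ H] {A : H →L[ℂ] H} {d : ℂ} (h : HasFredholmDet A d) {ι : Type}
    (e : HilbertBasis ι ℂ H) :
    HasSum (principalMinor fun i j => inner ℂ (e i) (A (e j))) d :=
  h ι e

theorem eq_zero_of_norm_mul_add_sq_mul_le {a b : ℂ} {c : ℝ}
    (h : ∀ t : ℝ, 0 < t → t ≤ 1 → ‖t * a + t ^ 2 * b‖ ≤ t ^ 3 * c) : a = 0 ∧ b = 0 := by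
  have aux : ∀ {z : ℂ} {k : ℝ}, (∀ t : ℝ, 0 < t → t ≤ 1 → ‖z‖ ≤ t * k) → z = 0 := by
    intro z k hz
    have h1 : Tendsto (fun t : ℝ => t * k) (𝓝[>] 0) (𝓝 0) := by
      have : Tendsto (fun t : ℝ => t * k) (𝓝 0) (𝓝 (0 * k)) := tendsto_id.mul_const k
      rw [zero_mul] at this
      exact this.mono_left nhdsWithin_le_nhds
    have h2 : ∀ᶠ t : ℝ in 𝓝[>] 0, ‖z‖ ≤ t * k := by
      filter_upwards [Ioc_mem_nhdsGT (zero_lt_one' ℝ)] with t ht using hz t ht.1 ht.2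
    exact norm_le_zero_iff.1 (ge_of_tendsto h1 h2)
  have ha : a = 0 := by
    refine aux (k := |c| + ‖b‖) fun t ht0 ht1 => ?_
    have h1 := h t ht0 ht1
    have h2 : t * ‖a‖ ≤ ‖t * a + t ^ 2 * b‖ + t ^ 2 * ‖b‖ := by
      have := norm_sub_le (t * a + t ^ 2 * b) (t ^ 2 * b)
      simpa [abs_of_pos ht0] using this
    have h3 : t ^ 3 * c ≤ t ^ 2 * |c| := by
      calc t ^ 3 * c ≤ t ^ 3 * |c| := by gcongr; exact le_abs_self c
        _ ≤ t ^ 2 * |c| :=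
          mul_le_mul_of_nonneg_right (pow_le_pow_of_le_one ht0.le ht1 (by norm_num)) (abs_nonneg c)
    have h4 : t * ‖a‖ ≤ t * (t * (|c| + ‖b‖)) := by nlinarith
    exact le_of_mul_le_mul_left h4 ht0
  refine ⟨ha, aux (k := c) fun t ht0 ht1 => ?_⟩
  have h1 := h t ht0 ht1
  rw [ha] at h1
  have h2 : t ^ 2 * ‖b‖ ≤ t ^ 2 * (t * c) := by
    have : ‖(t : ℂ) * 0 + t ^ 2 * b‖ = t ^ 2 * ‖b‖ := by simp [abs_of_pos ht0]
    rw [this] at h1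
    linarith
  exact le_of_mul_le_mul_left h2 (by positivity)

/-- The remainder is ∑ t^k e_k(a) over k ≥ 3, which is nonnegative and at most t³ ∑ e_k(a). -/
theorem prod_one_add_mul_expansion {σ : Type*} (F : Finset σ) (a : σ → ℝ)
    (h0 : ∀ i, 0 ≤ a i) {t : ℝ} (ht0 : 0 ≤ t) (ht1 : t ≤ 1) :
    0 ≤ ∏ i ∈ F, (1 + t * a i) - 1 - t * ∑ i ∈ F, a i -
        t ^ 2 * (((∑ i ∈ F, a i) ^ 2 - ∑ i ∈ F, a i ^ 2) / 2) ∧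
      ∏ i ∈ F, (1 + t * a i) - 1 - t * ∑ i ∈ F, a i -
        t ^ 2 * (((∑ i ∈ F, a i) ^ 2 - ∑ i ∈ F, a i ^ 2) / 2) ≤ t ^ 3 * ∏ i ∈ F, (1 + a i) := by
  classical
  -- The remainders of all lower orders are carried along: a new factor adds t a_j times the
  -- remainder of order k - 1 to that of order k.
  suffices h : (1 ≤ ∏ i ∈ F, (1 + t * a i) ∧
      ∏ i ∈ F, (1 + t * a i) ≤ ∏ i ∈ F, (1 + a i)) ∧
      ∏ i ∈ F, (1 + t * a i) - 1 ≤ t * ∏ i ∈ F, (1 + a i) ∧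
      (0 ≤ ∏ i ∈ F, (1 + t * a i) - 1 - t * ∑ i ∈ F, a i ∧
        ∏ i ∈ F, (1 + t * a i) - 1 - t * ∑ i ∈ F, a i ≤ t ^ 2 * ∏ i ∈ F, (1 + a i)) ∧
      0 ≤ ∏ i ∈ F, (1 + t * a i) - 1 - t * ∑ i ∈ F, a i -
        t ^ 2 * (((∑ i ∈ F, a i) ^ 2 - ∑ i ∈ F, a i ^ 2) / 2) ∧
      ∏ i ∈ F, (1 + t * a i) - 1 - t * ∑ i ∈ F, a i -
        t ^ 2 * (((∑ i ∈ F, a i) ^ 2 - ∑ i ∈ F, a i ^ 2) / 2) ≤ t ^ 3 * ∏ i ∈ F, (1 + a i) from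
    h.2.2.2
  induction F using Finset.induction_on with
  | empty => simp [ht0, pow_nonneg ht0]
  | insert j F hj ih =>
    simp only [Finset.prod_insert hj, Finset.sum_insert hj]
    generalize ∏ i ∈ F, (1 + t * a i) = p at *
    generalize ∏ i ∈ F, (1 + a i) = q at *
    generalize ∑ i ∈ F, a i = s at *
    generalize ∑ i ∈ F, a i ^ 2 = u at *
    obtain ⟨⟨i1, i2⟩, i3, ⟨i4, i5⟩, i6, i7⟩ := ih
    have b0 := h0 j
    have hp : 0 ≤ p := by linarith
    have hq : 0 ≤ q := by linarith
    have hta : 0 ≤ t * a j := by positivity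
    refine ⟨⟨?_, ?_⟩, ?_, ⟨?_, ?_⟩, ?_, ?_⟩
    · nlinarith [mul_nonneg hta hp]
    · refine mul_le_mul ?_ i2 hp (by linarith)
      nlinarith
    · nlinarith [mul_le_mul_of_nonneg_left i2 hta]
    · nlinarith [mul_nonneg hta (sub_nonneg.2 i1)]
    · nlinarith [mul_le_mul_of_nonneg_left i3 hta]
    · nlinarith [mul_nonneg hta i4]
    · nlinarith [mul_le_mul_of_nonneg_left i5 hta]

/-! ### Additive and multiplicative functionals of a configuration. -/

section Configuration

variable {M : Type*} [PseudoMetricSpace M]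

/-- The positions of the particles of `X` in the bounded set `B`. -/
noncomputable def Configuration.positions (X : Configuration M) {B : Set M}
    (hB : Bornology.IsBounded B) : Finset M :=
  (X.finite_of_isBounded B hB).toFinset

theorem additive_eq_sum (X : Configuration M) {B : Set M} (hB : Bornology.IsBounded B)
    {f : M → ℝ} (hf : ∀ x, x ∉ B → f x = 0) :
    additive f X = ∑ x ∈ X.positions hB, (X.mult x : ℝ) * f x := by
  refine finsum_eq_sum_of_support_subset _ fun x hx => ?_
  have hx' : (X.mult x : ℝ) * f x ≠ 0 := hx
  simp only [Configuration.positions, Set.Finite.coe_toFinset]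
  refine ⟨by_contra fun h => hx' (by simp [hf x h]), ?_⟩
  exact fun h => hx' (by simp [h])

theorem count_eq_sum (X : Configuration M) {A B : Set M} (hB : Bornology.IsBounded B)
    (hA : A ⊆ B) :
    (count A X : ℝ) = ∑ x ∈ X.positions hB, A.indicator (fun x => (X.mult x : ℝ)) x := by
  have h : count A X = ∑ x ∈ X.positions hB, A.indicator X.mult x := by
    unfold count
    rw [finsum_mem_def]
    refine finsum_eq_sum_of_support_subset _ fun x hx => ?_
    rw [Set.support_indicator] at hx
    simp only [Configuration.positions, Set.Finite.coe_toFinset]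
    exact ⟨hA hx.1, hx.2⟩
  rw [h]
  push_cast
  refine Finset.sum_congr rfl fun x _ => ?_
  by_cases hx : x ∈ A <;> simp [hx]

theorem multiplicative_eq_prod (X : Configuration M) {B : Set M} (hB : Bornology.IsBounded B)
    {g : M → ℂ} (hg : ∀ x, x ∉ B → g x = 1) :
    multiplicative g X = ∏ x ∈ X.positions hB, g x ^ X.mult x := by
  refine finprod_eq_prod_of_mulSupport_subset _ fun x hx => ?_
  have hx' : g x ^ X.mult x ≠ 1 := hx
  simp only [Configuration.positions, Set.Finite.coe_toFinset]
  refine ⟨by_contra fun h => hx' (by simp [hg x h]), ?_⟩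
  exact fun h => hx' (by simp [h])

theorem additive_add (X : Configuration M) {B : Set M} (hB : Bornology.IsBounded B)
    {f g : M → ℝ} (hf : ∀ x, x ∉ B → f x = 0) (hg : ∀ x, x ∉ B → g x = 0) :
    additive (fun x => f x + g x) X = additive f X + additive g X := by
  rw [additive_eq_sum X hB hf, additive_eq_sum X hB hg, ← Finset.sum_add_distrib,
    additive_eq_sum X hB fun x hx => by rw [hf x hx, hg x hx, add_zero]]
  exact Finset.sum_congr rfl fun x _ => mul_add _ _ _

theorem additive_indicator_one (X : Configuration M) {B : Set M} (hB : Bornology.IsBounded B) :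
    additive (B.indicator fun _ => 1) X = count B X := by
  rw [count_eq_sum X hB subset_rfl, additive_eq_sum X hB fun x hx => by simp [hx]]
  refine Finset.sum_congr rfl fun x _ => ?_
  by_cases hx : x ∈ B <;> simp [hx]

theorem multiplicative_expansion (X : Configuration M) {B : Set M} (hB : Bornology.IsBounded B)
    {f : M → ℝ} (h0 : ∀ x, 0 ≤ f x) (hf : ∀ x, x ∉ B → f x = 0) {t : ℝ}
    (ht0 : 0 ≤ t) (ht1 : t ≤ 1) :
    ∃ p q : ℝ, multiplicative (fun x => 1 + (t : ℂ) * f x) X = p ∧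
      multiplicative (fun x => 1 + (f x : ℂ)) X = q ∧ 0 ≤ q ∧
      0 ≤ p - 1 - t * additive f X -
        t ^ 2 * ((additive f X ^ 2 - additive (fun x => f x ^ 2) X) / 2) ∧
      p - 1 - t * additive f X -
        t ^ 2 * ((additive f X ^ 2 - additive (fun x => f x ^ 2) X) / 2) ≤ t ^ 3 * q := by
  -- The index set lists each particle as often as its multiplicity.
  have h := prod_one_add_mul_expansion
    ((X.positions hB).sigma fun x => Finset.range (X.mult x)) (fun p => f p.1)
    (fun p => h0 p.1) ht0 ht1
  simp only [Finset.prod_sigma, Finset.sum_sigma, Finset.prod_const, Finset.sum_const,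
    Finset.card_range, nsmul_eq_mul] at h
  rw [← additive_eq_sum X hB hf,
    ← additive_eq_sum X hB (f := fun x => f x ^ 2) fun x hx => by simp [hf x hx]] at h
  refine ⟨_, _, ?_, ?_, ?_, h⟩
  · rw [multiplicative_eq_prod X hB fun x hx => by simp [hf x hx]]
    push_cast; rfl
  · rw [multiplicative_eq_prod X hB fun x hx => by simp [hf x hx]]
    push_cast; rfl
  · exact Finset.prod_nonneg fun x _ => pow_nonneg (by linarith [h0 x]) _

theorem additive_nonneg (X : Configuration M) {f : M → ℝ} (h0 : ∀ x, 0 ≤ f x) :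
    0 ≤ additive f X :=
  finsum_nonneg fun x => mul_nonneg (Nat.cast_nonneg _) (h0 x)

theorem additive_mono (X : Configuration M) {B : Set M} (hB : Bornology.IsBounded B)
    {f g : M → ℝ} (hf : ∀ x, x ∉ B → f x = 0) (hg : ∀ x, x ∉ B → g x = 0)
    (hfg : ∀ x, f x ≤ g x) : additive f X ≤ additive g X := by
  rw [additive_eq_sum X hB hf, additive_eq_sum X hB hg]
  exact Finset.sum_le_sum fun x _ => mul_le_mul_of_nonneg_left (hfg x) (Nat.cast_nonneg _)

theorem additive_sq_le_sq (X : Configuration M) {B : Set M} (hB : Bornology.IsBounded B)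
    {f : M → ℝ} (h0 : ∀ x, 0 ≤ f x) (hf : ∀ x, x ∉ B → f x = 0) :
    additive (fun x => f x ^ 2) X ≤ additive f X ^ 2 := by
  have h := Finset.sum_sq_le_sq_sum_of_nonneg
    (s := (X.positions hB).sigma fun x => Finset.range (X.mult x)) (f := fun p => f p.1)
    fun p _ => h0 p.1
  simp only [Finset.sum_sigma, Finset.sum_const, Finset.card_range, nsmul_eq_mul] at h
  rwa [← additive_eq_sum X hB hf,
    ← additive_eq_sum X hB (f := fun x => f x ^ 2) fun x hx => by simp [hf x hx]] at h

theorem sum_indicator_le_eq_floor (n : ℕ) {a : ℝ} (ha1 : a ≤ 1) :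
    ∑ k ∈ Finset.Icc 1 n, (if (k : ℝ) ≤ a * n then (1 : ℝ) else 0) = ⌊a * n⌋₊ := by
  rw [← Finset.sum_filter, Finset.sum_const, nsmul_eq_mul, mul_one]
  congr 1
  have h : Finset.filter (fun k : ℕ => (k : ℝ) ≤ a * n) (Finset.Icc 1 n) =
      Finset.Icc 1 ⌊a * n⌋₊ := by
    ext k
    simp only [Finset.mem_filter, Finset.mem_Icc]
    constructor
    · rintro ⟨⟨h1, h2⟩, h3⟩
      exact ⟨h1, Nat.le_floor h3⟩
    · rintro ⟨h1, h2⟩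
      have h3 := (Nat.le_floor_iff' (by omega)).1 h2
      refine ⟨⟨h1, ?_⟩, h3⟩
      have h4 : (k : ℝ) ≤ n :=
        h3.trans ((mul_le_mul_of_nonneg_right ha1 (Nat.cast_nonneg n)).trans_eq (one_mul _))
      exact_mod_cast h4
  rw [h, Nat.card_Icc, Nat.add_sub_cancel]

/-- Since ⌊n f⌋/n is the average of the indicators of {f ≥ k/n}, 1 ≤ k ≤ n, the functional is a
limit of averages of counts of superlevel sets inside `B`. The σ-algebra on `Ω` is left free so that
it can be the one generated by the particles outside a given set. -/
theorem measurable_additive_of_count [MeasurableSpace M] {Ω : Type*} [MeasurableSpace Ω]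
    (X : Ω → Configuration M) {B : Set M} (hB : Bornology.IsBounded B) (hBm : MeasurableSet B)
    (hX : ∀ A, MeasurableSet A → A ⊆ B → Measurable fun ω => count A (X ω))
    {f : M → ℝ} (hfm : Measurable f) (h0 : ∀ x, 0 ≤ f x) (h1 : ∀ x, f x ≤ 1)
    (hf : ∀ x, x ∉ B → f x = 0) : Measurable fun ω => additive f (X ω) := by
  let A : ℕ → ℕ → Set M := fun n k => {x | x ∈ B ∧ (k : ℝ) ≤ f x * n}
  have hA : ∀ n k, MeasurableSet (A n k) := fun n k =>
    hBm.inter (measurableSet_le measurable_const (hfm.mul_const _))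
  refine measurable_of_tendsto_metrizable
    (f := fun (n : ℕ) ω => (∑ k ∈ Finset.Icc 1 n, (count (A n k) (X ω) : ℝ)) / n)
    (fun n => (Finset.measurable_sum _ fun k _ =>
      (measurable_from_top (f := fun m : ℕ => (m : ℝ))).comp (hX _ (hA n k)
        fun x hx => hx.1)).div_const _) ?_
  refine tendsto_pi_nhds.2 fun ω => ?_
  rw [additive_eq_sum (X ω) hB hf]
  have h2 : ∀ n : ℕ, (∑ k ∈ Finset.Icc 1 n, (count (A n k) (X ω) : ℝ)) / n =
      ∑ x ∈ (X ω).positions hB, ((X ω).mult x : ℝ) * ((⌊f x * n⌋₊ : ℝ) / n) := by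
    intro n
    simp only [count_eq_sum (X ω) hB (fun x (hx : x ∈ A n _) => hx.1)]
    rw [Finset.sum_comm, Finset.sum_div]
    refine Finset.sum_congr rfl fun x hx => ?_
    have hxB : x ∈ B := by
      simp only [Configuration.positions, Set.Finite.mem_toFinset] at hx
      exact hx.1
    rw [← mul_div_assoc, ← sum_indicator_le_eq_floor n (h1 x), Finset.mul_sum]
    congr 1
    refine Finset.sum_congr rfl fun k _ => ?_
    by_cases hk : (k : ℝ) ≤ f x * n
    · have : x ∈ A n k := ⟨hxB, hk⟩
      simp [this, hk]
    · have : x ∉ A n k := fun h => hk h.2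
      simp [this, hk]
  refine Tendsto.congr (fun n => (h2 n).symm) ?_
  refine tendsto_finsetSum _ fun x _ => Tendsto.const_mul _ ?_
  exact (tendsto_nat_floor_mul_div_atTop (h0 x)).comp tendsto_natCast_atTop_atTop

theorem measurable_count [MeasurableSpace M] {A C : Set M} (hA : Bornology.IsBounded A)
    (hAm : MeasurableSet A) (hAC : A ⊆ C) : Measurable[countSigma C] (count A) := by
  refine Measurable.mono (comap_measurable (count A)) ?_ le_rfl
  exact le_iSup₂_of_le A ⟨hA, hAm, hAC⟩ le_rfl

theorem measurable_additive_countSigma [MeasurableSpace M] {B C : Set M}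
    (hB : Bornology.IsBounded B) (hBm : MeasurableSet B) (hBC : B ⊆ C)
    {f : M → ℝ} (hfm : Measurable f) (h0 : ∀ x, 0 ≤ f x) (h1 : ∀ x, f x ≤ 1)
    (hf : ∀ x, x ∉ B → f x = 0) : Measurable[countSigma C] (additive f) :=
  @measurable_additive_of_count M _ _ (Configuration M) (countSigma C) id B hB hBm
    (fun _ hAm hAB => measurable_count (hB.subset hAB) hAm (hAB.trans hBC)) f hfm h0 h1 hf

theorem measurable_additive [MeasurableSpace M] {B : Set M}
    (hB : Bornology.IsBounded B) (hBm : MeasurableSet B)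
    {f : M → ℝ} (hfm : Measurable f) (h0 : ∀ x, 0 ≤ f x) (h1 : ∀ x, f x ≤ 1)
    (hf : ∀ x, x ∉ B → f x = 0) : Measurable (additive f) :=
  measurable_additive_countSigma hB hBm (Set.subset_univ B) hfm h0 h1 hf

end Configuration

/-! ### Algebra of multiplication operators. -/

section MulOp

variable {M : Type*} [MeasurableSpace M] {μ : Measure M}

theorem mulOp_apply_eq_smul {h h' : M → ℂ} (hh : BoundedMeasurable h)
    (hh' : BoundedMeasurable h') {t : ℂ} (ht : ∀ x, h x = t * h' x) (v : Lp ℂ 2 μ) :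
    mulOp μ h hh v = t • mulOp μ h' hh' v := by
  refine Lp.ext ?_
  filter_upwards [mulOp_apply_ae μ h hh v, mulOp_apply_ae μ h' hh' v,
    Lp.coeFn_smul t (mulOp μ h' hh' v)] with x h1 h2 h3
  rw [h1, h3, Pi.smul_apply, h2, ht, smul_eq_mul, mul_assoc]

theorem mulOp_congr {h h' : M → ℂ} (hh : BoundedMeasurable h)
    (hh' : BoundedMeasurable h') (e : ∀ x, h x = h' x) : mulOp μ h hh = mulOp μ h' hh' := by
  obtain rfl : h = h' := funext e
  rfl

theorem mulOp_comp_mulOp {h h' k : M → ℂ} (hh : BoundedMeasurable h)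
    (hh' : BoundedMeasurable h') (hk : BoundedMeasurable k) (e : ∀ x, h x * h' x = k x) :
    mulOp μ h hh ∘L mulOp μ h' hh' = mulOp μ k hk := by
  ext1 v
  refine Lp.ext ?_
  filter_upwards [mulOp_apply_ae μ h hh (mulOp μ h' hh' v), mulOp_apply_ae μ h' hh' v,
    mulOp_apply_ae μ k hk v] with x h1 h2 h3
  rw [h3, ContinuousLinearMap.comp_apply, h1, h2, ← e, mul_assoc]

theorem mulOp_add_mulOp {h h' : M → ℂ} (hh : BoundedMeasurable h)
    (hh' : BoundedMeasurable h') (e : ∀ x, h x + h' x = 1) :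
    mulOp μ h hh + mulOp μ h' hh' = ContinuousLinearMap.id ℂ _ := by
  ext1 v
  refine Lp.ext ?_
  filter_upwards [mulOp_apply_ae μ h hh v, mulOp_apply_ae μ h' hh' v,
    Lp.coeFn_add (mulOp μ h hh v) (mulOp μ h' hh' v)] with x h1 h2 h3
  rw [add_apply, h3, Pi.add_apply, h1, h2, ← add_mul, e, one_mul]
  rfl

theorem adjoint_mulOp {h : M → ℂ} (hh : BoundedMeasurable h)
    (e : ∀ x, starRingEnd ℂ (h x) = h x) :
    ContinuousLinearMap.adjoint (mulOp μ h hh) = mulOp μ h hh := by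
  symm
  rw [ContinuousLinearMap.eq_adjoint_iff]
  intro u v
  rw [L2.inner_def, L2.inner_def]
  refine integral_congr_ae ?_
  filter_upwards [mulOp_apply_ae μ h hh u, mulOp_apply_ae μ h hh v] with x h1 h2
  rw [h1, h2]
  simp only [RCLike.inner_apply, map_mul, e]
  ring

theorem boundedMeasurable_ofReal {f : M → ℝ} (hfm : Measurable f) (h0 : ∀ x, 0 ≤ f x)
    (h1 : ∀ x, f x ≤ 1) : BoundedMeasurable fun x => (f x : ℂ) :=
  ⟨Complex.measurable_ofReal.comp hfm, 1, fun x => by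
    rw [Complex.norm_real, Real.norm_eq_abs, abs_of_nonneg (h0 x)]; exact h1 x⟩

end MulOp

/-! ### Moments and the variance formula for a determinantal process. -/

section Moments

variable {M : Type} [PseudoMetricSpace M] [MeasurableSpace M] {μ : Measure M}
  {Q : Lp ℂ 2 μ →L[ℂ] Lp ℂ 2 μ} {P : Measure (Configuration M)}

/-- The determinant and the expected product are both expanded in `t`. The errors are t³ times the
absolute sum of the minors and t³ times the expectation of ∏ (1 + f), so the coefficients of t and
t² agree. -/
theorem IsDeterminantal.moments [IsProbabilityMeasure P] (hP : IsDeterminantal μ Q P)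
    {B : Set M} (hB : Bornology.IsBounded B) (hBm : MeasurableSet B)
    {f : M → ℝ} (hfm : Measurable f) (h0 : ∀ x, 0 ≤ f x) (h1 : ∀ x, f x ≤ 1)
    (hf : ∀ x, x ∉ B → f x = 0) {ι : Type} (e : HilbertBasis ι ℂ (Lp ℂ 2 μ))
    {N : ι → ι → ℂ} (hN : ∀ i j, N i j = inner ℂ (e i)
      ((mulOp μ _ (boundedMeasurable_ofReal hfm h0 h1) ∘L Q ∘L
        mulOp μ _ (boundedMeasurable_indicator hBm)) (e j))) :
    Summable (principalMinor N) ∧ Integrable (additive f) P ∧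
      Integrable (fun X => additive f X ^ 2) P ∧
      ((∫ X, additive f X ∂P : ℝ) : ℂ) = minorCoeff N 1 ∧
      (((∫ X, additive f X ^ 2 ∂P) - ∫ X, additive (fun x => f x ^ 2) X ∂P : ℝ) : ℂ) =
        2 * minorCoeff N 2 := by
  have hgm : ∀ t : ℝ, BoundedMeasurable fun x => 1 + (t : ℂ) * f x := fun t =>
    ⟨((Complex.measurable_ofReal.comp hfm).const_mul _).const_add _, 1 + |t|, fun x => by
      refine (norm_add_le _ _).trans ?_
      rw [norm_one, norm_mul, Complex.norm_real, Complex.norm_real, Real.norm_eq_abs,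
        Real.norm_eq_abs, abs_of_nonneg (h0 x)]
      have := mul_le_mul_of_nonneg_left (h1 x) (abs_nonneg t)
      linarith⟩
  have hdet : ∀ t : ℝ, Integrable (multiplicative fun x => 1 + (t : ℂ) * f x) P ∧
      HasSum (principalMinor fun i j => (t : ℂ) * N i j)
        (∫ X, multiplicative (fun x => 1 + (t : ℂ) * f x) X ∂P) := by
    intro t
    obtain ⟨hi, hd⟩ := hP _ B (hgm t) hBm hB fun x hx => by simp [hf x hx]
    refine ⟨hi, ?_⟩
    have h := hd.hasSum_principalMinor e
    convert h using 3
    ext i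
    rw [hN]
    simp only [ContinuousLinearMap.comp_apply]
    rw [mulOp_apply_eq_smul (hgm t).sub_one (boundedMeasurable_ofReal hfm h0 h1) (t := t)
      (fun x => by ring), inner_smul_right]
  have hsum : Summable (principalMinor N) := by
    have := (hdet 1).2.summable
    simpa using this
  have hq : Integrable (fun X => ‖multiplicative (fun x => 1 + (f x : ℂ)) X‖) P := by
    have := (hdet 1).1.norm
    simpa using this
  have hSm : Measurable (additive f) := measurable_additive hB hBm hfm h0 h1 hf
  have hsq0 : ∀ x, 0 ≤ f x ^ 2 := fun x => sq_nonneg _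
  have hsqf : ∀ x, x ∉ B → f x ^ 2 = 0 := fun x hx => by simp [hf x hx]
  have hS2m : Measurable (additive fun x => f x ^ 2) :=
    measurable_additive hB hBm (hfm.pow_const 2) hsq0
      (fun x => pow_le_one₀ (h0 x) (h1 x)) hsqf
  -- At t = 1 the nonnegative remainder shows that ∏ (1 + f), integrable by hypothesis, dominates
  -- both lower-order terms.
  have hbound : ∀ X, additive f X ≤ ‖multiplicative (fun x => 1 + (f x : ℂ)) X‖ ∧
      (additive f X ^ 2 - additive (fun x => f x ^ 2) X) / 2 ≤
        ‖multiplicative (fun x => 1 + (f x : ℂ)) X‖ := by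
    intro X
    obtain ⟨p, q, hp, hq, hq0, hl, -⟩ := multiplicative_expansion X hB h0 hf zero_le_one le_rfl
    have hpq : p = q := by
      simp only [Complex.ofReal_one, one_mul] at hp
      exact_mod_cast hp.symm.trans hq
    have hS := additive_nonneg X h0
    have hE := additive_sq_le_sq X hB h0 hf
    rw [hq, Complex.norm_real, Real.norm_eq_abs, abs_of_nonneg hq0]
    constructor <;> linarith
  have hSi : Integrable (additive f) P := by
    refine hq.mono' hSm.aestronglyMeasurable (Eventually.of_forall fun X => ?_)
    rw [Real.norm_eq_abs, abs_of_nonneg (additive_nonneg X h0)]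
    exact (hbound X).1
  have hS2i : Integrable (additive fun x => f x ^ 2) P := by
    refine hSi.mono' hS2m.aestronglyMeasurable (Eventually.of_forall fun X => ?_)
    rw [Real.norm_eq_abs, abs_of_nonneg (additive_nonneg X hsq0)]
    exact additive_mono X hB hsqf hf fun x => by nlinarith [h0 x, h1 x]
  have hEi : Integrable (fun X => (additive f X ^ 2 - additive (fun x => f x ^ 2) X) / 2) P := by
    refine hq.mono' (((hSm.pow_const 2).sub hS2m).div_const 2).aestronglyMeasurable
      (Eventually.of_forall fun X => ?_)
    have hE := additive_sq_le_sq X hB h0 hf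
    rw [Real.norm_eq_abs, abs_of_nonneg (by linarith)]
    exact (hbound X).2
  have hSqi : Integrable (fun X => additive f X ^ 2) P := by
    refine ((hEi.const_mul 2).add hS2i).congr (Eventually.of_forall fun X => ?_)
    simp only [Pi.add_apply]
    ring
  have hE : ∫ X, (additive f X ^ 2 - additive (fun x => f x ^ 2) X) / 2 ∂P =
      ((∫ X, additive f X ^ 2 ∂P) - ∫ X, additive (fun x => f x ^ 2) X ∂P) / 2 := by
    rw [integral_div, integral_sub hSqi hS2i]
  have hexp : ∀ t : ℝ, 0 < t → t ≤ 1 →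
      ‖(∫ X, multiplicative (fun x => 1 + (t : ℂ) * f x) X ∂P) - 1 -
        t * (∫ X, additive f X ∂P : ℝ) - t ^ 2 *
          (∫ X, (additive f X ^ 2 - additive (fun x => f x ^ 2) X) / 2 ∂P : ℝ)‖ ≤
        t ^ 3 * ∫ X, ‖multiplicative (fun x => 1 + (f x : ℂ)) X‖ ∂P := by
    intro t ht0 ht1
    have h := norm_integral_le_of_norm_le (f := fun X =>
        multiplicative (fun x => 1 + (t : ℂ) * f x) X - 1 - t * (additive f X : ℝ) - t ^ 2 *
          ((additive f X ^ 2 - additive (fun x => f x ^ 2) X) / 2 : ℝ))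
        (hq.const_mul (t ^ 3)) (Eventually.of_forall fun X => ?_)
    · rw [integral_const_mul, integral_sub, integral_sub, integral_sub (hdet t).1,
        integral_const_mul, integral_const_mul, integral_complex_ofReal,
        integral_complex_ofReal, integral_const] at h
      · simpa using h
      · exact integrable_const _
      · exact (hdet t).1.sub (integrable_const _)
      · exact hSi.ofReal.const_mul _
      · exact ((hdet t).1.sub (integrable_const _)).sub (hSi.ofReal.const_mul _)
      · exact hEi.ofReal.const_mul _
    · obtain ⟨p, q, hp, hq, hq0, hl, hu⟩ := multiplicative_expansion X hB h0 hf ht0.le ht1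
      simp only [hp, hq]
      rw [Complex.norm_real, Real.norm_eq_abs, abs_of_nonneg hq0]
      have h2 : (p : ℂ) - 1 - t * (additive f X : ℝ) - t ^ 2 *
          ((additive f X ^ 2 - additive (fun x => f x ^ 2) X) / 2 : ℝ) =
          ((p - 1 - t * additive f X -
        t ^ 2 * ((additive f X ^ 2 - additive (fun x => f x ^ 2) X) / 2) : ℝ) : ℂ) := by
        push_cast; ring
      rw [h2, Complex.norm_real, Real.norm_eq_abs, abs_of_nonneg hl]
      exact hu
  rw [hE] at hexp
  have hzero := eq_zero_of_norm_mul_add_sq_mul_le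
    (a := (∫ X, additive f X ∂P : ℝ) - minorCoeff N 1)
    (b := (((∫ X, additive f X ^ 2 ∂P) - ∫ X, additive (fun x => f x ^ 2) X ∂P) / 2 : ℝ) -
      minorCoeff N 2)
    (c := ∑' s, ‖principalMinor N s‖ + ∫ X, ‖multiplicative (fun x => 1 + (f x : ℂ)) X‖ ∂P)
    fun t ht0 ht1 => by
      have h2 := norm_sub_le_of_le
        (norm_det_sub_expansion_le hsum ht0.le ht1 (hdet t).2) (hexp t ht0 ht1)
      rw [← mul_add] at h2
      refine le_trans (le_of_eq ?_) h2
      congr 1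
      ring
  refine ⟨hsum, hSi, hSqi, sub_eq_zero.1 hzero.1, ?_⟩
  have h2 := sub_eq_zero.1 hzero.2
  rw [← h2]
  push_cast
  ring

/-- The diagonal entries of χQχ are ‖Qχ e_i‖², and they are summable because the Fredholm
determinant exists. The local decay of the kernel plays no role here. -/
theorem IsDeterminantal.hsNormSq_ne_top [IsProbabilityMeasure P] (hP : IsDeterminantal μ Q P)
    (hQ : IsStarProjection Q) {B : Set M} (hB : Bornology.IsBounded B) (hBm : MeasurableSet B)
    {ι : Type} (e : HilbertBasis ι ℂ (Lp ℂ 2 μ)) :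
    hsNormSq e (Q ∘L mulOp μ _ (boundedMeasurable_indicator hBm)) ≠ ∞ := by
  set χ := mulOp μ _ (boundedMeasurable_indicator hBm) with hχ
  have hQa : ContinuousLinearMap.adjoint Q = Q := hQ.isSelfAdjoint.adjoint_eq
  have hQQ : ∀ v, Q (Q v) = Q v := fun v => congrArg (fun A : Lp ℂ 2 μ →L[ℂ] Lp ℂ 2 μ => A v)
    hQ.isIdempotentElem
  have hχa : ContinuousLinearMap.adjoint χ = χ :=
    adjoint_mulOp _ fun x => by by_cases hx : x ∈ B <;> simp [hx]
  have hm := hP.moments hB hBm (f := B.indicator fun _ => 1) (measurable_const.indicator hBm)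
    (fun x => Set.indicator_nonneg (fun _ _ => zero_le_one) x)
    (fun x => Set.indicator_le_self' (fun _ _ => zero_le_one) x)
    (fun x hx => Set.indicator_of_notMem hx _) e (fun _ _ => rfl)
  have hs := (hasSum_diag_minorCoeff hm.1).summable.norm
  rw [mulOp_congr _ (boundedMeasurable_indicator hBm)
    fun x => by by_cases hx : x ∈ B <;> simp [hx]] at hs
  have h : ∀ i, ‖inner ℂ (e i) ((χ ∘L Q ∘L χ) (e i))‖ = ‖(Q ∘L χ) (e i)‖ ^ 2 := by
    intro i
    have h1 : inner ℂ (e i) ((χ ∘L Q ∘L χ) (e i)) = inner ℂ (Q (χ (e i))) (Q (χ (e i))) := by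
      rw [ContinuousLinearMap.comp_apply, ContinuousLinearMap.comp_apply,
        ← ContinuousLinearMap.adjoint_inner_left, hχa, ← hQQ (χ (e i)),
        ← ContinuousLinearMap.adjoint_inner_left, hQa, hQQ]
    rw [h1, inner_self_eq_norm_sq_to_K]
    simp
  simp only [← hχ, h] at hs
  unfold hsNormSq
  have := hs.tsum_ofReal_ne_top
  simpa only [ENNReal.ofReal_pow (norm_nonneg _), ofReal_norm] using this

/-- The moments give Var S_f = tr F²Qχ - tr (FQχ)² = ‖FQ‖² - ⟨QF, FQ⟩, while ‖QF‖ = ‖FQ‖ turns ‖FQ -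
QF‖² into twice the real part of this. -/
theorem IsDeterminantal.variance_additive [IsProbabilityMeasure P] (hP : IsDeterminantal μ Q P)
    (hQ : IsStarProjection Q) {B : Set M} (hB : Bornology.IsBounded B) (hBm : MeasurableSet B)
    {f : M → ℝ} (hfm : Measurable f) (h0 : ∀ x, 0 ≤ f x) (h1 : ∀ x, f x ≤ 1)
    (hf : ∀ x, x ∉ B → f x = 0) {ι : Type} (e : HilbertBasis ι ℂ (Lp ℂ 2 μ)) :
    MemLp (additive f) 2 P ∧
      hsNormSq e (mulOp μ _ (boundedMeasurable_ofReal hfm h0 h1) ∘L Q -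
        Q ∘L mulOp μ _ (boundedMeasurable_ofReal hfm h0 h1)) ≠ ∞ ∧
      2 * variance (additive f) P =
        (hsNormSq e (mulOp μ _ (boundedMeasurable_ofReal hfm h0 h1) ∘L Q -
          Q ∘L mulOp μ _ (boundedMeasurable_ofReal hfm h0 h1))).toReal := by
  have hHS := hP.hsNormSq_ne_top hQ hB hBm e
  obtain ⟨hsum, -, hSq, hE1, hE2⟩ := hP.moments hB hBm hfm h0 h1 hf e (fun _ _ => rfl)
  obtain ⟨hsum', -, -, hE1', -⟩ := hP.moments hB hBm (hfm.pow_const 2) (fun x => sq_nonneg (f x))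
      (fun x => pow_le_one₀ (h0 x) (h1 x)) (fun x hx => by simp [hf x hx]) e (fun _ _ => rfl)
  have hSm : Measurable (additive f) := measurable_additive hB hBm hfm h0 h1 hf
  have hmem : MemLp (additive f) 2 P := (memLp_two_iff_integrable_sq hSm.aestronglyMeasurable).2 hSq
  set χ := mulOp μ _ (boundedMeasurable_indicator hBm) with hχ
  set F := mulOp μ _ (boundedMeasurable_ofReal hfm h0 h1) with hF
  have hFF : mulOp μ _ (boundedMeasurable_ofReal (hfm.pow_const 2) (fun x => sq_nonneg (f x))
      (fun x => pow_le_one₀ (h0 x) (h1 x))) = F ∘L F :=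
    (mulOp_comp_mulOp _ _ _ fun x => by push_cast; ring).symm
  have hFχ : F ∘L χ = F := mulOp_comp_mulOp _ _ _ fun x => by
    by_cases hx : x ∈ B <;> simp [hx, hf]
  have hχF : χ ∘L F = F := mulOp_comp_mulOp _ _ _ fun x => by
    by_cases hx : x ∈ B <;> simp [hx, hf]
  have hQa : ContinuousLinearMap.adjoint Q = Q := hQ.isSelfAdjoint.adjoint_eq
  have hQQ : Q ∘L Q = Q := hQ.isIdempotentElem
  have hχa : ContinuousLinearMap.adjoint χ = χ :=
    adjoint_mulOp _ fun x => by by_cases hx : x ∈ B <;> simp [hx]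
  have hFa : ContinuousLinearMap.adjoint F = F := adjoint_mulOp _ fun x => by simp
  have hQF : hsNormSq e (Q ∘L F) ≠ ∞ := by
    rw [← hχF, ← ContinuousLinearMap.comp_assoc]
    exact hsNormSq_comp_ne_top' e F hHS
  have hQFa : ContinuousLinearMap.adjoint (Q ∘L F) = F ∘L Q := by
    rw [ContinuousLinearMap.adjoint_comp, hQa, hFa]
  have hFQ : hsNormSq e (F ∘L Q) ≠ ∞ := by rw [← hQFa, hsNormSq_adjoint]; exact hQF
  -- the trace of `F² Q χ`
  have htr : minorCoeff (fun i j => inner ℂ (e i) (((F ∘L F) ∘L Q ∘L χ) (e j))) 1 =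
      ((hsNormSq e (F ∘L Q)).toReal : ℂ) := by
    rw [hFF] at hsum'
    have h1 : minorCoeff (fun i j => inner ℂ (e i) (((F ∘L F) ∘L Q ∘L χ) (e j))) 1 =
        hsInner e (Q ∘L F ∘L F) (Q ∘L χ) := by
      rw [← (hasSum_diag_minorCoeff hsum').tsum_eq]
      refine tsum_congr fun i => ?_
      have h2 : Q (Q (χ (e i))) = Q (χ (e i)) :=
        congrArg (fun A : Lp ℂ 2 μ →L[ℂ] Lp ℂ 2 μ => A (χ (e i))) hQQ
      have h3 : inner ℂ (Q (F (F (e i)))) (Q (χ (e i))) =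
          inner ℂ (F (F (e i))) (Q (Q (χ (e i)))) := by
        have := ContinuousLinearMap.adjoint_inner_left Q (Q (χ (e i))) (F (F (e i)))
        rwa [hQa] at this
      simp only [ContinuousLinearMap.comp_apply]
      rw [h3, h2, ← ContinuousLinearMap.adjoint_inner_left F, hFa,
        ← ContinuousLinearMap.adjoint_inner_left F, hFa]
    rw [h1, hsNormSq_toReal, ← hsInner_self, ← hsInner_adjoint e _ hHS,
      ContinuousLinearMap.adjoint_comp, ContinuousLinearMap.adjoint_comp,
      ContinuousLinearMap.adjoint_comp, hQa, hFa, hχa, ContinuousLinearMap.comp_assoc F F Q,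
      hsInner_comp_right, hFa, ← ContinuousLinearMap.comp_assoc, hFχ]
    rw [← ContinuousLinearMap.comp_assoc]
    exact hsNormSq_comp_ne_top' e F hQF
  -- the trace of `(F Q χ)²`
  have hA : hsNormSq e (F ∘L Q ∘L χ) ≠ ∞ := by
    rw [← ContinuousLinearMap.comp_assoc]
    exact hsNormSq_comp_ne_top' e χ hFQ
  have hAa : ContinuousLinearMap.adjoint (F ∘L Q ∘L χ) = χ ∘L Q ∘L F := by
    rw [ContinuousLinearMap.adjoint_comp, ContinuousLinearMap.adjoint_comp, hQa, hFa, hχa,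
      ContinuousLinearMap.comp_assoc]
  have hq := hasSum_hsInner e (S := ContinuousLinearMap.adjoint (F ∘L Q ∘L χ))
    (by rwa [hsNormSq_adjoint]) hA
  simp only [ContinuousLinearMap.adjoint_inner_left] at hq
  -- Both factors χ are absorbed by χF = F, the second one after passing to adjoints.
  have hqe : hsInner e (ContinuousLinearMap.adjoint (F ∘L Q ∘L χ)) (F ∘L Q ∘L χ) =
      hsInner e (Q ∘L F) (F ∘L Q) := by
    have h1 : hsInner e (χ ∘L (Q ∘L F)) (F ∘L Q ∘L χ) = hsInner e (Q ∘L F) (F ∘L Q ∘L χ) := by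
      have := hsInner_comp_right e (Q ∘L F) χ (F ∘L Q ∘L χ)
      rw [hχa] at this
      rw [← this, ← ContinuousLinearMap.comp_assoc χ F, hχF]
    rw [hAa, h1, ← hsInner_adjoint e hQF hA, hAa, hQFa]
    have h2 := hsInner_comp_right e (Q ∘L F) χ (F ∘L Q)
    rw [hχa, ← ContinuousLinearMap.comp_assoc χ F, hχF] at h2
    rw [← h2]
  rw [hqe] at hq
  have hc := two_mul_minorCoeff_two hsum hq
  have hvar : variance (additive f) P = (∫ X, additive f X ^ 2 ∂P) - (∫ X, additive f X ∂P) ^ 2 :=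
    variance_eq_sub hmem
  have hD := hsNormSq_sub_toReal e hQF hFQ
  rw [← neg_sub, hsNormSq_neg] at hD
  have hne : hsNormSq e (F ∘L Q - Q ∘L F) ≠ ∞ := by
    have h := hsNormSq_add_add_le e (F ∘L Q) (-(Q ∘L F)) 0
    rw [add_zero, ← sub_eq_add_neg] at h
    refine ne_top_of_le_ne_top ?_ h
    rw [hsNormSq_neg]
    have : hsNormSq e 0 = 0 := by simp [hsNormSq]
    rw [this]
    exact ENNReal.mul_ne_top (by simp) (by simp [hFQ, hQF])
  refine ⟨hmem, hne, ?_⟩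
  have hQFn : hsNormSq e (Q ∘L F) = hsNormSq e (F ∘L Q) := by rw [← hQFa, hsNormSq_adjoint]
  rw [hD, hQFn, hvar]
  rw [hFF] at hE1'
  rw [htr] at hE1'
  rw [hc, ← hE1] at hE2
  have h3 := congrArg Complex.re hE2
  have h4 := congrArg Complex.re hE1'
  simp only [Complex.ofReal_re, Complex.sub_re, ← Complex.ofReal_pow] at h3 h4
  linarith

end Moments

/-! ### Integral kernels and Hilbert–Schmidt norms. -/

section Kernel

variable {M : Type*} [MeasurableSpace M] {μ : Measure M}

theorem enorm_sq_eq_lintegral (f : Lp ℂ 2 μ) : ‖f‖ₑ ^ 2 = ∫⁻ x, ‖f x‖ₑ ^ 2 ∂μ := by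
  have h := eLpNorm_nnreal_pow_eq_lintegral (f := f) (μ := μ) (p := 2) (by norm_num)
  rw [Lp.enorm_def]
  simpa using h

variable {K K' : M → M → ℂ} {Q Q' : Lp ℂ 2 μ →L[ℂ] Lp ℂ 2 μ}

theorem IsKernelOf.sub (hK : IsKernelOf μ K Q) (hK' : IsKernelOf μ K' Q') :
    IsKernelOf μ (fun x y => K x y - K' x y) (Q - Q') := by
  refine ⟨hK.1.sub hK'.1, fun f => ?_⟩
  filter_upwards [hK.2 f, hK'.2 f, Lp.coeFn_sub (Q f) (Q' f)] with x h1 h2 h3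
  simp only [sub_mul]
  refine ⟨h1.1.sub h2.1, ?_⟩
  rw [integral_sub h1.1 h2.1, ← h1.2, ← h2.2, sub_apply, h3, Pi.sub_apply]

theorem IsKernelOf.mulOp_comp [SFinite μ] (hK : IsKernelOf μ K Q) {h : M → ℂ}
    (hh : BoundedMeasurable h) :
    IsKernelOf μ (fun x y => h x * K x y) (mulOp μ h hh ∘L Q) := by
  refine ⟨(hh.1.comp measurable_fst).aestronglyMeasurable.mul hK.1, fun f => ?_⟩
  filter_upwards [hK.2 f, mulOp_apply_ae μ h hh (Q f)] with x h1 h2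
  simp only [mul_assoc]
  refine ⟨h1.1.const_mul _, ?_⟩
  rw [integral_const_mul, ← h1.2, ContinuousLinearMap.comp_apply, h2]

theorem IsKernelOf.comp_mulOp [SFinite μ] (hK : IsKernelOf μ K Q) {h : M → ℂ}
    (hh : BoundedMeasurable h) :
    IsKernelOf μ (fun x y => K x y * h y) (Q ∘L mulOp μ h hh) := by
  refine ⟨hK.1.mul (hh.1.comp measurable_snd).aestronglyMeasurable, fun f => ?_⟩
  filter_upwards [hK.2 (mulOp μ h hh f)] with x h1
  have h2 : (fun y => K x y * (mulOp μ h hh f) y) =ᵐ[μ] fun y => K x y * h y * f y := by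
    filter_upwards [mulOp_apply_ae μ h hh f] with y hy
    rw [hy, mul_assoc]
  exact ⟨h1.1.congr h2, by rw [← integral_congr_ae h2, ← h1.2]; rfl⟩

/-- At almost every x, (Q e_i)(x) is the inner product of e_i with the conjugate row K(x, ·), and
Parseval is applied row by row. -/
theorem IsKernelOf.hsNormSq_le [SFinite μ] (hK : IsKernelOf μ K Q) {ι : Type*}
    (e : HilbertBasis ι ℂ (Lp ℂ 2 μ)) :
    hsNormSq e Q ≤ ∫⁻ x, ∫⁻ y, ‖K x y‖ₑ ^ 2 ∂μ ∂μ := by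
  -- Countability of `ι` is not assumed, so exceptional null sets are united only over finite sets
  -- of indices.
  rw [hsNormSq, ENNReal.tsum_eq_iSup_sum]
  refine iSup_le fun s => ?_
  simp only [enorm_sq_eq_lintegral]
  rw [← lintegral_finsetSum' _ fun i _ => (Lp.aestronglyMeasurable _).enorm.pow_const 2]
  refine lintegral_mono_ae ?_
  have h1 : ∀ᵐ x ∂μ, ∀ i ∈ s, Q (e i) x = ∫ y, K x y * e i y ∂μ := by
    rw [Filter.eventually_all_finset]
    exact fun i _ => (hK.2 (e i)).mono fun x hx => hx.2
  filter_upwards [h1, hK.1.prodMk_left] with x hx hm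
  by_cases htop : ∫⁻ y, ‖K x y‖ₑ ^ 2 ∂μ = ∞
  · rw [htop]; exact le_top
  have hmem : MemLp (fun y => starRingEnd ℂ (K x y)) 2 μ := by
    refine ⟨hm.star, ?_⟩
    have h := eLpNorm_nnreal_pow_eq_lintegral (f := fun y => starRingEnd ℂ (K x y)) (μ := μ)
      (p := 2) (by norm_num)
    simp only [RCLike.enorm_conj] at h
    by_contra hcon
    rw [not_lt, top_le_iff] at hcon
    refine htop ?_
    simpa [hcon] using h.symm
  have hnorm : ‖hmem.toLp _‖ₑ ^ 2 = ∫⁻ y, ‖K x y‖ₑ ^ 2 ∂μ := by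
    rw [enorm_sq_eq_lintegral]
    refine lintegral_congr_ae ?_
    filter_upwards [hmem.coeFn_toLp] with y hy
    rw [hy, RCLike.enorm_conj]
  rw [← hnorm, enorm_sq_eq_tsum_inner e]
  refine le_trans (le_of_eq (Finset.sum_congr rfl fun i hi => ?_)) (ENNReal.sum_le_tsum s)
  rw [hx i hi, ← inner_conj_symm, RCLike.enorm_conj, L2.inner_def]
  congr 2
  refine integral_congr_ae ?_
  filter_upwards [hmem.coeFn_toLp] with y hy
  rw [hy, RCLike.inner_apply, RCLike.conj_conj, mul_comm]

/-- The commutator D is cut into χD, χ'Dχ and χ'Dχ'. As D* = -D, the block χ'Dχ has the norm of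
χDχ', so x can be kept in `A` without assuming K(x, y) to be pointwise Hermitian. -/
theorem hsNormSq_commutator_le [SFinite μ] (hK : IsKernelOf μ K Q) (hQ : IsSelfAdjoint Q)
    {f : M → ℝ} (hf : BoundedMeasurable fun x => (f x : ℂ)) {A : Set M} (hA : MeasurableSet A)
    {ι : Type*} (e : HilbertBasis ι ℂ (Lp ℂ 2 μ)) :
    hsNormSq e (mulOp μ _ hf ∘L Q - Q ∘L mulOp μ _ hf) ≤
      3 * (2 * (∫⁻ x in A, ∫⁻ y, ‖f x - f y‖ₑ ^ 2 * ‖K x y‖ₑ ^ 2 ∂μ ∂μ) +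
        ∫⁻ x in Aᶜ, ∫⁻ y in Aᶜ, ‖f x - f y‖ₑ ^ 2 * ‖K x y‖ₑ ^ 2 ∂μ ∂μ) := by
  set F := mulOp μ _ hf
  set χ := mulOp μ _ (boundedMeasurable_indicator hA)
  set χ' := mulOp μ _ (boundedMeasurable_indicator hA.compl)
  set D := F ∘L Q - Q ∘L F with hD
  have hFa : ContinuousLinearMap.adjoint F = F := adjoint_mulOp _ fun x => by simp
  have hχa : ContinuousLinearMap.adjoint χ = χ :=
    adjoint_mulOp _ fun x => by by_cases hx : x ∈ A <;> simp [hx]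
  have hχa' : ContinuousLinearMap.adjoint χ' = χ' :=
    adjoint_mulOp _ fun x => by by_cases hx : x ∈ A <;> simp [hx]
  have hDa : ContinuousLinearMap.adjoint D = -D := by
    rw [hD, map_sub, ContinuousLinearMap.adjoint_comp, ContinuousLinearMap.adjoint_comp, hFa,
      hQ.adjoint_eq, neg_sub]
  have hone : χ + χ' = ContinuousLinearMap.id ℂ _ :=
    mulOp_add_mulOp _ _ fun x => by by_cases hx : x ∈ A <;> simp [hx]
  have hdecomp : D = χ ∘L D + (χ' ∘L D) ∘L χ + (χ' ∘L D) ∘L χ' := by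
    rw [add_assoc, ← ContinuousLinearMap.comp_add, hone, ContinuousLinearMap.comp_id,
      ← ContinuousLinearMap.add_comp, hone, ContinuousLinearMap.id_comp]
  have hcross : hsNormSq e ((χ' ∘L D) ∘L χ) = hsNormSq e ((χ ∘L D) ∘L χ') := by
    rw [← hsNormSq_adjoint, ContinuousLinearMap.adjoint_comp, ContinuousLinearMap.adjoint_comp,
      hχa, hχa', hDa, ContinuousLinearMap.neg_comp, ContinuousLinearMap.comp_neg, hsNormSq_neg,
      ContinuousLinearMap.comp_assoc]
  have hkD : IsKernelOf μ (fun x y => (f x : ℂ) * K x y - K x y * (f y : ℂ)) D :=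
    (hK.mulOp_comp hf).sub (hK.comp_mulOp hf)
  have hknorm : ∀ x y, ‖(f x : ℂ) * K x y - K x y * (f y : ℂ)‖ₑ ^ 2 =
      ‖f x - f y‖ₑ ^ 2 * ‖K x y‖ₑ ^ 2 := by
    intro x y
    rw [← mul_pow, mul_comm (K x y), ← sub_mul, enorm_mul, ← Complex.ofReal_sub]
    congr 2
    rw [← ofReal_norm, ← ofReal_norm, Complex.norm_real]
  have hχD := (hkD.mulOp_comp (boundedMeasurable_indicator hA)).hsNormSq_le e
  have hχDχ := ((hkD.mulOp_comp (boundedMeasurable_indicator hA)).comp_mulOp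
    (boundedMeasurable_indicator hA.compl)).hsNormSq_le e
  have hχ'Dχ' := ((hkD.mulOp_comp (boundedMeasurable_indicator hA.compl)).comp_mulOp
    (boundedMeasurable_indicator hA.compl)).hsNormSq_le e
  have hb1 : hsNormSq e (χ ∘L D) ≤
      ∫⁻ x in A, ∫⁻ y, ‖f x - f y‖ₑ ^ 2 * ‖K x y‖ₑ ^ 2 ∂μ ∂μ := by
    refine hχD.trans ?_
    rw [← lintegral_indicator hA]
    refine lintegral_mono fun x => ?_
    by_cases hx : x ∈ A <;> simp [hx, hknorm]
  have hb2 : hsNormSq e ((χ ∘L D) ∘L χ') ≤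
      ∫⁻ x in A, ∫⁻ y, ‖f x - f y‖ₑ ^ 2 * ‖K x y‖ₑ ^ 2 ∂μ ∂μ := by
    refine hχDχ.trans ?_
    rw [← lintegral_indicator hA]
    refine lintegral_mono fun x => ?_
    by_cases hx : x ∈ A
    · simp only [hx, Set.indicator_of_mem, one_mul]
      refine lintegral_mono fun y => ?_
      by_cases hy : y ∈ A <;> simp [hy, hknorm]
    · simp [hx]
  have hb3 : hsNormSq e ((χ' ∘L D) ∘L χ') ≤
      ∫⁻ x in Aᶜ, ∫⁻ y in Aᶜ, ‖f x - f y‖ₑ ^ 2 * ‖K x y‖ₑ ^ 2 ∂μ ∂μ := by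
    refine hχ'Dχ'.trans ?_
    rw [← lintegral_indicator hA.compl]
    refine lintegral_mono fun x => ?_
    by_cases hx : x ∈ Aᶜ
    · simp only [hx, Set.indicator_of_mem, one_mul]
      rw [← lintegral_indicator hA.compl]
      refine lintegral_mono fun y => ?_
      by_cases hy : y ∈ A <;> simp [hy, hknorm]
    · simp [hx]
  have h := hsNormSq_add_add_le e (χ ∘L D) ((χ' ∘L D) ∘L χ) ((χ' ∘L D) ∘L χ')
  rw [← hdecomp, hcross] at h
  refine h.trans ?_
  rw [two_mul]
  gcongr

end Kernel

/-! ### Pointwise estimates for the logarithmic cutoff. -/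

section LogCutoff

variable {R T : ℝ}

theorem log_max_one_div_nonneg (R T x : ℝ) :
    0 ≤ if |x| ≤ T then Real.log (max 1 (|x| - R)) / Real.log (T - R) else 0 := by
  split_ifs with hx
  · rcases le_or_gt (T - R) 1 with h | h
    · rw [max_eq_left (by linarith)]; simp
    · exact div_nonneg (Real.log_nonneg (le_max_left _ _)) (Real.log_nonneg h.le)
  · exact le_rfl

theorem logCutoff_le_one (R T x : ℝ) : logCutoff R T x ≤ 1 := by
  have := log_max_one_div_nonneg R T x
  unfold logCutoff
  split_ifs at * <;> linarith

theorem logCutoff_nonneg (R T x : ℝ) : 0 ≤ logCutoff R T x := by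
  unfold logCutoff
  split_ifs with hx
  -- If T - R ≤ 1, the numerator is log 1 = 0 for |x| ≤ T, so neither the sign of the denominator
  -- nor division by zero matters.
  · rcases le_or_gt (T - R) 1 with h | h
    · rw [max_eq_left (by linarith)]; simp
    · rw [sub_nonneg]
      refine div_le_one_of_le₀ ?_ (Real.log_nonneg h.le)
      exact Real.log_le_log (by positivity) (max_le h.le (by linarith))
  · exact le_rfl

theorem measurable_logCutoff (R T : ℝ) : Measurable (logCutoff R T) := by
  unfold logCutoff
  refine Measurable.ite (measurableSet_le measurable_norm measurable_const) ?_ measurable_const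
  exact ((Real.measurable_log.comp (measurable_const.max
    (measurable_norm.sub_const R))).div_const _).const_sub 1

theorem logCutoff_eq_zero {x : ℝ} (hx : x ∉ Metric.closedBall (0 : ℝ) T) :
    logCutoff R T x = 0 := by
  rw [mem_closedBall_zero_iff, Real.norm_eq_abs] at hx
  exact if_neg hx

theorem logCutoff_eq_one {x : ℝ} (hx : |x| ≤ R + 1) (hRT : R + 1 < T) :
    logCutoff R T x = 1 := by
  rw [logCutoff, if_pos (by linarith), max_eq_left (by linarith)]
  simp

theorem logCutoff_eq_of_one_lt (hRT : R + 1 < T) (x : ℝ) :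
    logCutoff R T x = 1 - min 1 (Real.log (max 1 (|x| - R)) / Real.log (T - R)) := by
  have hL : 0 < Real.log (T - R) := Real.log_pos (by linarith)
  unfold logCutoff
  split_ifs with hx
  · rw [min_eq_right]
    rw [div_le_one hL]
    exact Real.log_le_log (by positivity) (max_le (by linarith) (by linarith))
  · rw [min_eq_left, sub_self]
    rw [le_div_iff₀ hL, one_mul]
    exact Real.log_le_log (by linarith) (le_max_of_le_right (by linarith [not_le.1 hx]))

theorem one_sub_logCutoff_le (hR : 0 ≤ R) (hRT : R + 1 < T) (x : ℝ) :
    1 - logCutoff R T x ≤ Real.log (max 1 |x|) / Real.log (T - R) := by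
  have hL : 0 < Real.log (T - R) := Real.log_pos (by linarith)
  rw [logCutoff_eq_of_one_lt hRT, sub_sub_cancel]
  refine (min_le_right _ _).trans (div_le_div_of_nonneg_right ?_ hL.le)
  exact Real.log_le_log (by positivity) (max_le_max le_rfl (by linarith))

theorem abs_logCutoff_sub_le (hR : 0 ≤ R) (hRT : R + 1 < T) {x y : ℝ} (hx : 0 < |x|)
    (hxy : |x| ≤ |y|) :
    |logCutoff R T x - logCutoff R T y| ≤
      Real.log (1 + (1 + R) * ((|y| - |x|) / |x|)) / Real.log (T - R) := by
  have hL : 0 < Real.log (T - R) := Real.log_pos (by linarith)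
  have hm : max 1 (|x| - R) ≤ max 1 (|y| - R) := max_le_max le_rfl (by linarith)
  have h1 : (1 : ℝ) ≤ max 1 (|x| - R) := le_max_left _ _
  have hlog : Real.log (max 1 (|x| - R)) ≤ Real.log (max 1 (|y| - R)) :=
    Real.log_le_log (by positivity) hm
  have hdiv := div_le_div_of_nonneg_right hlog hL.le
  rw [logCutoff_eq_of_one_lt hRT, logCutoff_eq_of_one_lt hRT, sub_sub_sub_cancel_left,
    abs_of_nonneg (sub_nonneg.2 (min_le_min le_rfl hdiv))]
  have h2 : min 1 (Real.log (max 1 (|y| - R)) / Real.log (T - R)) -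
      min 1 (Real.log (max 1 (|x| - R)) / Real.log (T - R)) ≤
      Real.log (max 1 (|y| - R)) / Real.log (T - R) -
        Real.log (max 1 (|x| - R)) / Real.log (T - R) := by
    rcases le_total 1 (Real.log (max 1 (|x| - R)) / Real.log (T - R)) with h | h
    · rw [min_eq_left h, min_eq_left (h.trans hdiv)]; linarith
    · rw [min_eq_right h]
      exact sub_le_sub_right (min_le_right _ _) _
  refine h2.trans ?_
  rw [← sub_div, ← Real.log_div (by positivity) (by positivity)]
  refine div_le_div_of_nonneg_right (Real.log_le_log (by positivity) ?_) hL.le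
  rw [div_le_iff₀ (by positivity)]
  have h3 : max 1 (|y| - R) ≤ max 1 (|x| - R) + (|y| - |x|) :=
    max_le (by linarith) (by linarith [le_max_right 1 (|x| - R)])
  -- The shift by R costs only the factor 1 + R.
  have h4 : |x| ≤ (1 + R) * max 1 (|x| - R) := by
    nlinarith [le_max_right 1 (|x| - R)]
  have h5 : |y| - |x| ≤ (1 + R) * ((|y| - |x|) / |x|) * max 1 (|x| - R) := by
    have : (1 + R) * ((|y| - |x|) / |x|) * max 1 (|x| - R) =
        (|y| - |x|) * (((1 + R) * max 1 (|x| - R)) / |x|) := by ring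
    rw [this]
    exact le_mul_of_one_le_right (by linarith) ((one_le_div hx).2 h4)
  linarith

theorem log_one_add_le_rpow_div {u δ : ℝ} (hu : 0 ≤ u) (hδ : 0 < δ) (hδ1 : δ ≤ 1) :
    Real.log (1 + u) ≤ u ^ δ / δ := by
  rw [le_div_iff₀ hδ, mul_comm, ← Real.log_rpow (by linarith)]
  have h1 : (1 + u) ^ δ ≤ 1 + u ^ δ := by
    simpa using Real.rpow_add_le_add_rpow zero_le_one hu hδ.le hδ1
  refine (Real.log_le_log (by positivity) h1).trans ?_
  have := Real.log_le_sub_one_of_pos (show 0 < 1 + u ^ δ by positivity)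
  linarith

/-- The profile that controls the energy of the logarithmic cutoff between the distances `a` and
`b` from the origin. -/
noncomputable def energyProfile (γ a b : ℝ) : ℝ :=
  if b ≤ 2 * a then a ^ (-2 : ℝ) else a ^ (-γ) * b ^ (γ - 2)

/-- If |y| ≤ 2|x|, then log (1 + u) ≤ u cancels the singularity 1/|x - y|. If |y| > 2|x|, then |x -
y| ≥ |y|/2, and log (1 + u) ≤ u^δ/δ costs only a small power of |y/x|. -/
theorem cutoff_energy_density_le {α δ C : ℝ} (hα : 0 < α) (hα' : α < 1 / 2)
    (hδ : δ = (1 / 2 - α) / 2) (hC : 0 ≤ C) (hR : 0 < R) (hRT : R + 1 < T) {x y : ℝ}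
    (hx : R < |x|) (hxy : |x| ≤ |y|) (hne : x ≠ y) :
    |logCutoff R T x - logCutoff R T y| ^ 2 *
        (C * ((|x / y| ^ α + |y / x| ^ α) / |x - y|)) ^ 2 ≤
      16 * C ^ 2 * (1 + R) ^ 2 / δ ^ 2 / Real.log (T - R) ^ 2 *
        energyProfile (α + 1 / 2) |x| |y| := by
  have hL : 0 < Real.log (T - R) := Real.log_pos (by linarith)
  have hδ0 : 0 < δ := by rw [hδ]; linarith
  have hδ1 : δ ≤ 1 := by rw [hδ]; linarith
  have ha : 0 < |x| := hR.trans hx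
  have hb : 0 < |y| := ha.trans_le hxy
  have hd : 0 < |x - y| := abs_pos.2 (sub_ne_zero.2 hne)
  have hdist : |y| - |x| ≤ |x - y| := by
    rw [abs_sub_comm]; exact abs_sub_abs_le_abs_sub _ _
  have hφ := abs_logCutoff_sub_le hR.le hRT ha hxy
  set u := (1 + R) * ((|y| - |x|) / |x|) with hu
  have hu0 : 0 ≤ u := mul_nonneg (by linarith) (div_nonneg (by linarith) ha.le)
  rw [abs_div, abs_div]
  have h1r : 1 ≤ |y| / |x| := (one_le_div ha).2 hxy
  have hxy1 : (|x| / |y|) ^ α ≤ 1 :=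
    Real.rpow_le_one (by positivity) ((div_le_one hb).2 hxy) hα.le
  have hyx1 : 1 ≤ (|y| / |x|) ^ α := Real.one_le_rpow h1r hα.le
  have hpow : (|x| / |y|) ^ α + (|y| / |x|) ^ α ≤ 2 * (|y| / |x|) ^ α := by linarith
  rw [← mul_pow]
  set L := Real.log (T - R)
  unfold energyProfile
  split_ifs with hcase
  · have h2 : (|y| / |x|) ^ α ≤ 2 := by
      calc (|y| / |x|) ^ α ≤ (2 : ℝ) ^ α :=
            Real.rpow_le_rpow (by positivity) ((div_le_iff₀ ha).2 hcase) hα.le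
        _ ≤ (2 : ℝ) ^ (1 : ℝ) := Real.rpow_le_rpow_of_exponent_le (by norm_num) (by linarith)
        _ = 2 := Real.rpow_one 2
    have h3 : |logCutoff R T x - logCutoff R T y| ≤ (1 + R) * (|x - y| / |x|) / L := by
      refine hφ.trans (div_le_div_of_nonneg_right ?_ hL.le)
      have := Real.log_le_sub_one_of_pos (show 0 < 1 + u by linarith)
      refine (show Real.log (1 + u) ≤ u by linarith).trans ?_
      rw [hu]
      gcongr
    have h4 : |logCutoff R T x - logCutoff R T y| *
        (C * (((|x| / |y|) ^ α + (|y| / |x|) ^ α) / |x - y|)) ≤ 4 * C * (1 + R) / L * |x|⁻¹ := by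
      calc _ ≤ (1 + R) * (|x - y| / |x|) / L * (C * (4 / |x - y|)) := by
            gcongr
            linarith
        _ = _ := by field_simp
    calc _ ≤ (4 * C * (1 + R) / L * |x|⁻¹) ^ 2 := by gcongr
      _ = 16 * C ^ 2 * (1 + R) ^ 2 / 1 / L ^ 2 * |x| ^ (-2 : ℝ) := by
        rw [Real.rpow_neg ha.le, Real.rpow_two]; ring
      _ ≤ _ := by
        gcongr
        exact pow_le_one₀ hδ0.le hδ1
  · have hcase' : 2 * |x| < |y| := not_le.1 hcase
    have h3 : |logCutoff R T x - logCutoff R T y| ≤ (1 + R) * (|y| / |x|) ^ δ / δ / L := by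
      refine hφ.trans (div_le_div_of_nonneg_right ?_ hL.le)
      refine (log_one_add_le_rpow_div hu0 hδ0 hδ1).trans (div_le_div_of_nonneg_right ?_ hδ0.le)
      calc u ^ δ ≤ ((1 + R) * (|y| / |x|)) ^ δ := by
            refine Real.rpow_le_rpow hu0 ?_ hδ0.le
            rw [hu]
            gcongr
            linarith
        _ = (1 + R) ^ δ * (|y| / |x|) ^ δ := Real.mul_rpow (by linarith) (by positivity)
        _ ≤ (1 + R) * (|y| / |x|) ^ δ := by
            gcongr
            calc (1 + R) ^ δ ≤ (1 + R) ^ (1 : ℝ) :=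
                  Real.rpow_le_rpow_of_exponent_le (by linarith) hδ1
              _ = 1 + R := Real.rpow_one _
    have h4 : |logCutoff R T x - logCutoff R T y| *
        (C * (((|x| / |y|) ^ α + (|y| / |x|) ^ α) / |x - y|)) ≤
          4 * C * (1 + R) / δ / L * ((|y| / |x|) ^ δ * (|y| / |x|) ^ α * |y|⁻¹) := by
      calc _ ≤ (1 + R) * (|y| / |x|) ^ δ / δ / L * (C * (2 * (|y| / |x|) ^ α / (|y| / 2))) := by
            gcongr
            linarith
        _ = _ := by field_simp; ring
    calc _ ≤ (4 * C * (1 + R) / δ / L * ((|y| / |x|) ^ δ * (|y| / |x|) ^ α * |y|⁻¹)) ^ 2 := by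
          gcongr
      _ = 16 * C ^ 2 * (1 + R) ^ 2 / δ ^ 2 / L ^ 2 *
          (((|y| / |x|) ^ δ * (|y| / |x|) ^ α) ^ 2 * (|y| ^ 2)⁻¹) := by ring
      _ = _ := by
        congr 1
        rw [← Real.rpow_add (by positivity), ← Real.rpow_natCast, ← Real.rpow_mul (by positivity),
          Real.div_rpow hb.le ha.le, Real.rpow_sub hb, Real.rpow_neg ha.le, Real.rpow_two]
        -- δ is half the gap between α and 1/2, so this exponent stays below 1 and the profile is
        -- integrable at infinity.
        have : (δ + α) * ((2 : ℕ) : ℝ) = α + 1 / 2 := by rw [hδ]; push_cast; ring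
        rw [this]
        field_simp

end LogCutoff

/-! ### One-dimensional integrals. -/

theorem lintegral_comp_abs_eq {g : ℝ → ℝ≥0∞} (hg : Measurable g) :
    ∫⁻ y : ℝ, g |y| = 2 * ∫⁻ y in Set.Ioi 0, g y := by
  have hpos : ∫⁻ y in Set.Ioi (0 : ℝ), g |y| = ∫⁻ y in Set.Ioi 0, g y :=
    setLIntegral_congr_fun measurableSet_Ioi fun y hy => by rw [abs_of_pos hy]
  have hneg : ∫⁻ y in Set.Iio (0 : ℝ), g |y| = ∫⁻ y in Set.Ioi 0, g |y| := by
    have h := (Measure.measurePreserving_neg (volume : Measure ℝ)).setLIntegral_comp_preimage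
      (s := Set.Ioi 0) measurableSet_Ioi (f := fun y => g |y|) (hg.comp measurable_norm)
    simpa using h
  rw [← lintegral_add_compl _ (measurableSet_Ioi (a := (0 : ℝ))), Set.compl_Ioi,
    ← setLIntegral_congr (Iio_ae_eq_Iic (μ := volume) (a := (0 : ℝ))), hneg, hpos, two_mul]

theorem measurable_energyProfile (γ : ℝ) :
    Measurable fun p : ℝ × ℝ => energyProfile γ p.1 p.2 := by
  unfold energyProfile
  refine Measurable.ite (measurableSet_le measurable_snd (measurable_fst.const_mul 2)) ?_ ?_
  · exact measurable_fst.pow_const _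
  · exact (measurable_fst.pow_const _).mul (measurable_snd.pow_const _)

/-- The profile is homogeneous of degree -2, hence the 1/a; γ < 1 makes the tail converge. -/
theorem lintegral_energyProfile {γ a : ℝ} (hγ : γ < 1) (ha : 0 < a) :
    ∫⁻ y : ℝ, ENNReal.ofReal (energyProfile γ a |y|) =
      ENNReal.ofReal (2 * (2 + 2 ^ (γ - 1) / (1 - γ)) / a) := by
  have hm : Measurable fun y => ENNReal.ofReal (energyProfile γ a y) :=
    ((measurable_energyProfile γ).comp measurable_prodMk_left).ennreal_ofReal
  rw [lintegral_comp_abs_eq hm, ← Set.Ioc_union_Ioi_eq_Ioi (show 0 ≤ 2 * a by positivity),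
    lintegral_union measurableSet_Ioi (Set.Ioc_disjoint_Ioi le_rfl)]
  have h1 : ∫⁻ y in Set.Ioc 0 (2 * a), ENNReal.ofReal (energyProfile γ a y) =
      ENNReal.ofReal (2 / a) := by
    rw [setLIntegral_congr_fun (g := fun _ => ENNReal.ofReal (a ^ (-2 : ℝ))) measurableSet_Ioc
      fun y hy => by simp only [energyProfile, if_pos hy.2]]
    rw [setLIntegral_const, Real.volume_Ioc, ← ENNReal.ofReal_mul (by positivity),
      Real.rpow_neg ha.le, Real.rpow_two]
    congr 1
    field_simp
    ring
  have h2 : ∫⁻ y in Set.Ioi (2 * a), ENNReal.ofReal (energyProfile γ a y) =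
      ENNReal.ofReal (2 ^ (γ - 1) / (1 - γ) / a) := by
    rw [setLIntegral_congr_fun (g := fun y => ENNReal.ofReal (a ^ (-γ) * y ^ (γ - 2)))
      measurableSet_Ioi fun y hy => by
        simp only [energyProfile, if_neg (not_le.2 (Set.mem_Ioi.1 hy))]]
    rw [← ofReal_integral_eq_lintegral_ofReal
      ((integrableOn_Ioi_rpow_of_lt (by linarith) (by positivity)).const_mul _), integral_const_mul,
      integral_Ioi_rpow_of_lt (by linarith) (by positivity)]
    · congr 1
      rw [show γ - 2 + 1 = γ - 1 by ring, Real.mul_rpow (by norm_num) ha.le,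
        Real.rpow_sub_one ha.ne' γ,
        Real.rpow_neg ha.le, ← neg_sub 1 γ]
      have : 1 - γ ≠ 0 := by linarith
      field_simp
    · filter_upwards [ae_restrict_mem measurableSet_Ioi] with y hy
      have : 0 < y := (show 0 < 2 * a by positivity).trans hy
      positivity
  have hγ' : 0 < 1 - γ := by linarith
  rw [h1, h2, ← ENNReal.ofReal_add (by positivity) (by positivity),
    show (2 : ℝ≥0∞) = ENNReal.ofReal 2 by simp, ← ENNReal.ofReal_mul (by norm_num)]
  congr 1
  ring

theorem lintegral_indicator_Ioo_div_abs {R T c : ℝ} (hR : 0 < R) (hRT : R ≤ T) (hc : 0 ≤ c) :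
    ∫⁻ x : ℝ, (Set.Ioo R T).indicator (fun a => ENNReal.ofReal (c / a)) |x| =
      ENNReal.ofReal (2 * c * Real.log (T / R)) := by
  rw [lintegral_comp_abs_eq (g := (Set.Ioo R T).indicator fun a => ENNReal.ofReal (c / a))
    ((measurable_const.div measurable_id).ennreal_ofReal.indicator measurableSet_Ioo),
    lintegral_indicator measurableSet_Ioo, Measure.restrict_restrict
    measurableSet_Ioo, Set.inter_eq_left.2 fun x hx => Set.mem_Ioi.2 (hR.trans hx.1),
    setLIntegral_congr Ioo_ae_eq_Ioc, ← ofReal_integral_eq_lintegral_ofReal]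
  · simp only [div_eq_mul_inv]
    rw [integral_const_mul, ← intervalIntegral.integral_of_le hRT,
      integral_inv_of_pos hR (hR.trans_le hRT), show (2 : ℝ≥0∞) = ENNReal.ofReal 2 by simp,
      ← ENNReal.ofReal_mul (by norm_num), mul_assoc]
    rfl
  · rw [← IntegrableOn, ← intervalIntegrable_iff_integrableOn_Ioc_of_le hRT]
    refine ContinuousOn.intervalIntegrable ?_
    refine continuousOn_const.div continuousOn_id fun x hx => ?_
    rw [Set.uIcc_of_le hRT] at hx
    exact (hR.trans_le hx.1).ne'
  · filter_upwards [ae_restrict_mem measurableSet_Ioc] with x hx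
    exact div_nonneg hc (hR.trans hx.1).le

theorem lintegral_log_sq_div_ne_top {ε : ℝ} (hε : 0 < ε) :
    ∫⁻ y : ℝ, ENNReal.ofReal (Real.log (max 1 |y|) ^ 2 / (1 + |y| ^ (1 + ε))) ≠ ∞ := by
  rw [lintegral_comp_abs_eq (g := fun y => ENNReal.ofReal (Real.log (max 1 y) ^ 2 /
    (1 + y ^ (1 + ε)))) (by fun_prop)]
  refine ENNReal.mul_ne_top (by simp) (ne_top_of_le_ne_top (b := ∫⁻ y in Set.Ioi (1 : ℝ),
    ENNReal.ofReal (16 / ε ^ 2 * y ^ (-1 - ε / 2))) ?_ ?_)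
  · have hi : IntegrableOn (fun y : ℝ => 16 / ε ^ 2 * y ^ (-1 - ε / 2)) (Set.Ioi 1) :=
      (integrableOn_Ioi_rpow_of_lt (by linarith) zero_lt_one).const_mul _
    exact hi.lintegral_lt_top.ne
  · rw [← lintegral_indicator measurableSet_Ioi, ← lintegral_indicator measurableSet_Ioi]
    refine lintegral_mono fun y => ?_
    by_cases hy : y ∈ Set.Ioi (1 : ℝ)
    · have hy1 : 1 < y := hy
      have hy0 : 0 < y := zero_lt_one.trans hy1
      rw [Set.indicator_of_mem hy, Set.indicator_of_mem (Set.mem_Ioi.2 hy0)]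
      refine ENNReal.ofReal_le_ofReal ?_
      rw [max_eq_right hy1.le]
      -- The exponent ε/4 becomes ε/2 on squaring and leaves the integrable power -1 - ε/2.
      have h1 := Real.log_le_rpow_div hy0.le (show 0 < ε / 4 by positivity)
      have h0 : 0 ≤ Real.log y := Real.log_nonneg hy1.le
      calc Real.log y ^ 2 / (1 + y ^ (1 + ε)) ≤ (y ^ (ε / 4) / (ε / 4)) ^ 2 / y ^ (1 + ε) := by
            gcongr
            linarith
        _ = 16 / ε ^ 2 * ((y ^ (ε / 4)) ^ 2 / y ^ (1 + ε)) := by field_simp; ring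
        _ = _ := by
            rw [← Real.rpow_natCast (y ^ (ε / 4)) 2, ← Real.rpow_mul hy0.le, ← Real.rpow_sub hy0]
            congr 2
            push_cast
            ring
    · rw [Set.indicator_of_notMem hy]
      by_cases hy0 : y ∈ Set.Ioi (0 : ℝ)
      · rw [Set.indicator_of_mem hy0, max_eq_left (not_lt.1 hy)]
        simp
      · rw [Set.indicator_of_notMem hy0]

/-! ### Energy of the cutoff near and away from the origin. -/

section Energy

variable {U : Set ℝ} {K : ℝ → ℝ → ℂ} {R T : ℝ}

/-- The cutoff is 1 at x, so the weight depends on y alone. After Tonelli the inner integral is the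
one bounded by `hlocal`. -/
theorem cutoff_energy_inner_le (hU : MeasurableSet U)
    (hK : AEStronglyMeasurable (Function.uncurry K)
      ((volume.restrict U).prod (volume.restrict U)))
    {C ε : ℝ} (hR : 0 ≤ R) (hRT : R + 1 < T)
    (hlocal : ∀ y ∈ U, ∫⁻ x in {x : ℝ | |x| ≤ R}, ‖K x y‖ₑ ^ 2 ∂(volume.restrict U)
        ≤ ENNReal.ofReal (C / (1 + |y| ^ (1 + ε)))) (hC : 0 ≤ C) :
    ∫⁻ x in {x : ℝ | |x| ≤ R}, ∫⁻ y, ‖logCutoff R T x - logCutoff R T y‖ₑ ^ 2 * ‖K x y‖ₑ ^ 2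
        ∂(volume.restrict U) ∂(volume.restrict U) ≤
      ENNReal.ofReal (C / Real.log (T - R) ^ 2) *
        ∫⁻ y : ℝ, ENNReal.ofReal (Real.log (max 1 |y|) ^ 2 / (1 + |y| ^ (1 + ε))) := by
  have hL : 0 < Real.log (T - R) := Real.log_pos (by linarith)
  have hA : MeasurableSet {x : ℝ | |x| ≤ R} := measurableSet_le measurable_norm measurable_const
  have hφ := measurable_logCutoff R T
  have hm : AEMeasurable (Function.uncurry fun x y =>
      ‖logCutoff R T x - logCutoff R T y‖ₑ ^ 2 * ‖K x y‖ₑ ^ 2)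
      (((volume.restrict U).restrict {x : ℝ | |x| ≤ R}).prod (volume.restrict U)) := by
    have hK' : AEStronglyMeasurable (Function.uncurry K)
        (((volume.restrict U).restrict {x : ℝ | |x| ≤ R}).prod (volume.restrict U)) :=
      hK.mono_ac (Measure.AbsolutelyContinuous.prod
        Measure.restrict_le_self.absolutelyContinuous Measure.AbsolutelyContinuous.rfl)
    have h1 : Measurable fun p : ℝ × ℝ => ‖logCutoff R T p.1 - logCutoff R T p.2‖ₑ ^ 2 :=
      (((hφ.comp measurable_fst).sub (hφ.comp measurable_snd)).enorm).pow_const 2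
    exact h1.aemeasurable.mul (hK'.enorm.pow_const 2)
  rw [lintegral_lintegral_swap hm, ← lintegral_const_mul' _ _ ENNReal.ofReal_ne_top]
  refine le_trans (lintegral_mono_ae ?_) (lintegral_mono' Measure.restrict_le_self le_rfl)
  filter_upwards [ae_restrict_mem hU] with y hy
  have h1 : ∫⁻ x in {x : ℝ | |x| ≤ R}, ‖logCutoff R T x - logCutoff R T y‖ₑ ^ 2 * ‖K x y‖ₑ ^ 2
        ∂(volume.restrict U) = ‖1 - logCutoff R T y‖ₑ ^ 2 *
        ∫⁻ x in {x : ℝ | |x| ≤ R}, ‖K x y‖ₑ ^ 2 ∂(volume.restrict U) := by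
    rw [← lintegral_const_mul' _ _ (by simp)]
    refine setLIntegral_congr_fun hA fun x hx => ?_
    simp only [logCutoff_eq_one (le_add_of_le_of_nonneg hx zero_le_one) hRT]
  rw [h1]
  refine (mul_le_mul_right (hlocal y hy) _).trans ?_
  rw [Real.enorm_of_nonneg (sub_nonneg.2 (logCutoff_le_one R T y)),
    ← ENNReal.ofReal_pow (sub_nonneg.2 (logCutoff_le_one R T y)),
    ← ENNReal.ofReal_mul (by positivity), ← ENNReal.ofReal_mul (by positivity)]
  refine ENNReal.ofReal_le_ofReal ?_
  have h2 := one_sub_logCutoff_le hR hRT y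
  have h3 := sub_nonneg.2 (logCutoff_le_one R T y)
  calc (1 - logCutoff R T y) ^ 2 * (C / (1 + |y| ^ (1 + ε))) ≤
      (Real.log (max 1 |y|) / Real.log (T - R)) ^ 2 * (C / (1 + |y| ^ (1 + ε))) := by gcongr
    _ = _ := by ring

theorem cutoff_energy_outer_le (hU : MeasurableSet U) {α δ C : ℝ} (hα : 0 < α) (hα' : α < 1 / 2)
    (hδ : δ = (1 / 2 - α) / 2) (hC : 0 ≤ C) (hR : 0 < R) (hRT : R + 1 < T)
    (hdecay : ∀ x ∈ U, ∀ y ∈ U, R ≤ |x| → R ≤ |y| → x ≠ y →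
      ‖K x y‖ ≤ C * ((|x / y| ^ α + |y / x| ^ α) / |x - y|)) :
    ∫⁻ x in {x : ℝ | |x| ≤ R}ᶜ, ∫⁻ y in {x : ℝ | |x| ≤ R}ᶜ,
        ‖logCutoff R T x - logCutoff R T y‖ₑ ^ 2 * ‖K x y‖ₑ ^ 2
        ∂(volume.restrict U) ∂(volume.restrict U) ≤
      2 * ENNReal.ofReal (2 * (16 * C ^ 2 * (1 + R) ^ 2 / δ ^ 2 / Real.log (T - R) ^ 2 *
        (2 * (2 + 2 ^ (α + 1 / 2 - 1) / (1 - (α + 1 / 2))))) * Real.log (T / R)) := by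
  have hL : 0 < Real.log (T - R) := Real.log_pos (by linarith)
  set c := 16 * C ^ 2 * (1 + R) ^ 2 / δ ^ 2 / Real.log (T - R) ^ 2 with hc
  set γ := α + 1 / 2 with hγ
  have hc0 : 0 ≤ c := by positivity
  have hγ1 : 0 < 1 - γ := by rw [hγ]; linarith
  have hA : MeasurableSet {x : ℝ | |x| ≤ R}ᶜ :=
    (measurableSet_le measurable_norm measurable_const).compl
  -- `H` handles the pairs in which x is nearer to the origin; H x y + H y x covers both orders.
  -- Only |x| < T counts, since beyond T both cutoffs vanish.
  let H : ℝ → ℝ → ℝ≥0∞ := fun x y =>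
    (Set.Ioo R T).indicator (fun a => ENNReal.ofReal (c * energyProfile γ a |y|)) |x|
  have hH : Measurable (Function.uncurry H) := by
    have h1 : Measurable fun p : ℝ × ℝ => ENNReal.ofReal (c * energyProfile γ |p.1| |p.2|) :=
      (((measurable_energyProfile γ).comp ((measurable_norm.comp measurable_fst).prodMk
        (measurable_norm.comp measurable_snd))).const_mul c).ennreal_ofReal
    have h2 : MeasurableSet {p : ℝ × ℝ | |p.1| ∈ Set.Ioo R T} :=
      (measurable_norm.comp measurable_fst) measurableSet_Ioo
    exact h1.indicator h2
  have hHint : ∫⁻ x, ∫⁻ y, H x y = ENNReal.ofReal (2 * (c *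
        (2 * (2 + 2 ^ (γ - 1) / (1 - γ)))) * Real.log (T / R)) := by
    rw [← lintegral_indicator_Ioo_div_abs hR (by linarith) (by positivity)]
    refine lintegral_congr fun x => ?_
    by_cases hx : |x| ∈ Set.Ioo R T
    · simp only [H, Set.indicator_of_mem hx, ENNReal.ofReal_mul hc0]
      rw [lintegral_const_mul' _ _ ENNReal.ofReal_ne_top,
        lintegral_energyProfile (by linarith) (hR.trans hx.1), ← ENNReal.ofReal_mul hc0]
      congr 1
      ring
    · simp [H, Set.indicator_of_notMem hx]
  have hbound : ∀ x y : ℝ, R < |x| → |x| ≤ |y| → x ≠ y →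
      ENNReal.ofReal (|logCutoff R T x - logCutoff R T y| ^ 2 *
        (C * ((|x / y| ^ α + |y / x| ^ α) / |x - y|)) ^ 2) ≤ H x y := by
    intro x y hx hxy hne
    by_cases hxT : |x| < T
    · simp only [H, Set.indicator_of_mem (show |x| ∈ Set.Ioo R T from ⟨hx, hxT⟩)]
      exact ENNReal.ofReal_le_ofReal
        (cutoff_energy_density_le hα hα' hδ hC hR hRT hx hxy hne)
    · have hz : ∀ z : ℝ, T ≤ |z| → logCutoff R T z = 0 := by
        intro z hz
        rw [logCutoff_eq_of_one_lt hRT, min_eq_left, sub_self]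
        rw [le_div_iff₀ hL, one_mul]
        exact Real.log_le_log (by linarith) (le_max_of_le_right (by linarith))
      rw [hz x (not_lt.1 hxT), hz y ((not_lt.1 hxT).trans hxy)]
      simp
  have hpoint : ∀ x ∈ U, ∀ y ∈ U, R < |x| → R < |y| →
      ‖logCutoff R T x - logCutoff R T y‖ₑ ^ 2 * ‖K x y‖ₑ ^ 2 ≤ H x y + H y x := by
    intro x hxU y hyU hx hy
    rcases eq_or_ne x y with rfl | hne
    · simp
    have hK := hdecay x hxU y hyU hx.le hy.le hne
    have h1 : ‖logCutoff R T x - logCutoff R T y‖ₑ ^ 2 * ‖K x y‖ₑ ^ 2 ≤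
        ENNReal.ofReal (|logCutoff R T x - logCutoff R T y| ^ 2 *
          (C * ((|x / y| ^ α + |y / x| ^ α) / |x - y|)) ^ 2) := by
      rw [← ofReal_norm, ← ofReal_norm, ← ENNReal.ofReal_pow (norm_nonneg _),
        ← ENNReal.ofReal_pow (norm_nonneg _), ← ENNReal.ofReal_mul (by positivity),
        Real.norm_eq_abs]
      refine ENNReal.ofReal_le_ofReal ?_
      gcongr
    refine h1.trans ?_
    rcases le_total |x| |y| with hxy | hxy
    · exact (hbound x y hx hxy hne).trans le_self_add
    · have h2 := hbound y x hy hxy hne.symm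
      rw [abs_sub_comm, add_comm (|y / x| ^ α), abs_sub_comm y x] at h2
      exact h2.trans le_add_self
  calc _ ≤ ∫⁻ x in {x : ℝ | |x| ≤ R}ᶜ, ∫⁻ y in {x : ℝ | |x| ≤ R}ᶜ, (H x y + H y x)
        ∂(volume.restrict U) ∂(volume.restrict U) := by
        refine lintegral_mono_ae ?_
        filter_upwards [ae_restrict_mem hA, ae_restrict_of_ae (ae_restrict_mem hU)] with x hx hxU
        refine lintegral_mono_ae ?_
        filter_upwards [ae_restrict_mem hA, ae_restrict_of_ae (ae_restrict_mem hU)] with y hy hyU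
        exact hpoint x hxU y hyU (not_le.1 hx) (not_le.1 hy)
    _ ≤ ∫⁻ x, ∫⁻ y, (H x y + H y x) := by
        have hle : (volume.restrict U).restrict {x : ℝ | |x| ≤ R}ᶜ ≤ volume :=
          Measure.restrict_le_self.trans Measure.restrict_le_self
        exact lintegral_mono' hle fun x => lintegral_mono' hle le_rfl
    _ = (∫⁻ x, ∫⁻ y, H x y) + ∫⁻ x, ∫⁻ y, H y x := by
        have hHm : Measurable fun x => ∫⁻ y, H x y := hH.lintegral_prod_right'
        rw [← lintegral_add_left hHm]
        refine lintegral_congr fun x => ?_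
        exact lintegral_add_left (hH.comp measurable_prodMk_left) _
    _ = _ := by
        rw [lintegral_lintegral_swap (f := fun x y => H y x)
          (hH.comp measurable_swap).aemeasurable, hHint]
        exact (two_mul _).symm

end Energy

/-! ### Almost sure limits and completed σ-algebras. -/

theorem measurable_eventuallyMeasurableSpace_of_tendsto {Ω : Type*} {m : MeasurableSpace Ω}
    {l : Filter Ω} [CountableInterFilter l] {N : Ω → ℕ} {h : ℕ → Ω → ℝ}
    (hm : ∀ n, Measurable (h n))
    (hlim : ∀ᶠ ω in l, Tendsto (fun n => h n ω) atTop (𝓝 (N ω : ℝ))) :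
    Measurable[eventuallyMeasurableSpace m l] N := by
  -- The floor gives a version with values in ℕ without changing the limit where it exists.
  have hf : Measurable fun ω => ⌊limsup (fun n => h n ω) atTop⌋₊ :=
    Nat.measurable_floor.comp (Measurable.limsup hm)
  refine hf.eventuallyMeasurable_of_eventuallyEq (hlim.mono fun ω hω => ?_)
  simp only [hω.limsup_eq, Nat.floor_natCast]

/-- The expected sum of the squared deviations is finite, so that sum converges almost surely and
its terms tend to 0. -/
theorem ae_tendsto_sub_integral_zero {Ω : Type*} {m : MeasurableSpace Ω} {P : Measure Ω}
    [IsProbabilityMeasure P] {S : ℕ → Ω → ℝ} (hS : ∀ n, MemLp (S n) 2 P)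
    (hv : ∀ n, variance (S n) P ≤ (1 / 2) ^ n) :
    ∀ᵐ ω ∂P, Tendsto (fun n => S n ω - ∫ ω, S n ω ∂P) atTop (𝓝 0) := by
  have hmeas : ∀ n, AEMeasurable (fun ω => ‖S n ω - ∫ ω, S n ω ∂P‖ₑ ^ 2) P := fun n =>
    ((hS n).aestronglyMeasurable.aemeasurable.sub_const _).enorm.pow_const 2
  have hsum : ∫⁻ ω, ∑' n, ‖S n ω - ∫ ω, S n ω ∂P‖ₑ ^ 2 ∂P ≠ ∞ := by
    rw [lintegral_tsum hmeas]
    have hle : ∀ n, ∫⁻ ω, ‖S n ω - ∫ ω, S n ω ∂P‖ₑ ^ 2 ∂P ≤ ENNReal.ofReal ((1 / 2) ^ n) := by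
      intro n
      have h := (hS n).ofReal_variance_eq
      rw [evariance] at h
      rw [← h]
      exact ENNReal.ofReal_le_ofReal (hv n)
    exact ne_top_of_le_ne_top summable_geometric_two.tsum_ofReal_ne_top
      (ENNReal.tsum_le_tsum hle)
  filter_upwards [ae_lt_top' (AEMeasurable.tsum hmeas) hsum] with ω hω
  have h1 := ENNReal.tendsto_atTop_zero_of_tsum_ne_top hω.ne
  have h2 := (ENNReal.tendsto_toReal ENNReal.zero_ne_top).comp h1
  have h3 : Tendsto (fun n => (S n ω - ∫ ω, S n ω ∂P) ^ 2) atTop (𝓝 0) := by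
    simpa [Function.comp_def] using h2
  have h4 := h3.sqrt
  simp only [Real.sqrt_sq_eq_abs, Real.sqrt_zero] at h4
  exact (tendsto_zero_iff_abs_tendsto_zero _).2 h4

/-! ### The variance bound and rigidity. -/

section Main

variable {U : Set ℝ} {K : ℝ → ℝ → ℂ}
  {Q : Lp ℂ 2 (volume.restrict U) →L[ℂ] Lp ℂ 2 (volume.restrict U)}
  {P : Measure (Configuration ℝ)}

theorem memLp_additive_logCutoff [IsProbabilityMeasure P] (hQ : IsStarProjection Q)
    (hP : IsDeterminantal (volume.restrict U) Q P) (R T : ℝ) :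
    MemLp (additive (logCutoff R T)) 2 P := by
  obtain ⟨w, e, -⟩ := exists_hilbertBasis ℂ (Lp ℂ 2 (volume.restrict U))
  exact (hP.variance_additive hQ Metric.isBounded_closedBall measurableSet_closedBall
    (measurable_logCutoff R T) (logCutoff_nonneg R T) (logCutoff_le_one R T)
    (fun _ => logCutoff_eq_zero) e).1

theorem exists_variance_logCutoff_le [IsProbabilityMeasure P] (hU : MeasurableSet U)
    (hQ : IsStarProjection Q) (hKQ : IsKernelOf (volume.restrict U) K Q)
    (hP : IsDeterminantal (volume.restrict U) Q P) {α ε C R : ℝ} (hα : 0 < α) (hα' : α < 1 / 2)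
    (hε : 0 < ε) (hC : 0 ≤ C) (hR : 0 < R)
    (hdecay : ∀ x ∈ U, ∀ y ∈ U, R ≤ |x| → R ≤ |y| → x ≠ y →
      ‖K x y‖ ≤ C * ((|x / y| ^ α + |y / x| ^ α) / |x - y|))
    (hlocal : ∀ y ∈ U, ∫⁻ x in {x : ℝ | |x| ≤ R}, ‖K x y‖ₑ ^ 2 ∂(volume.restrict U)
        ≤ ENNReal.ofReal (C / (1 + |y| ^ (1 + ε)))) :
    ∃ c₁ c₂ : ℝ, 0 ≤ c₁ ∧ 0 ≤ c₂ ∧ ∀ T, R + 1 < T →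
      variance (additive (logCutoff R T)) P ≤
        (c₁ + c₂ * Real.log (T / R)) / Real.log (T - R) ^ 2 := by
  obtain ⟨w, e, -⟩ := exists_hilbertBasis ℂ (Lp ℂ 2 (volume.restrict U))
  obtain ⟨δ, hδ⟩ : ∃ δ, δ = (1 / 2 - α) / 2 := ⟨_, rfl⟩
  have hW := lintegral_log_sq_div_ne_top hε
  set W := ∫⁻ y : ℝ, ENNReal.ofReal (Real.log (max 1 |y|) ^ 2 / (1 + |y| ^ (1 + ε))) with hWdef
  set k : ℝ := 16 * C ^ 2 * (1 + R) ^ 2 / δ ^ 2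
  set m : ℝ := 2 * (2 + 2 ^ (α + 1 / 2 - 1) / (1 - (α + 1 / 2)))
  have hk : 0 ≤ k := by positivity
  have hm : 0 ≤ m := by
    have : 0 < 1 - (α + 1 / 2) := by linarith
    positivity
  refine ⟨3 * C * W.toReal, 6 * k * m, by positivity, by positivity, fun T hRT => ?_⟩
  have hL : 0 < Real.log (T - R) := Real.log_pos (by linarith)
  have hTR : 0 ≤ Real.log (T / R) := Real.log_nonneg ((one_le_div hR).2 (by linarith))
  obtain ⟨-, -, hvar⟩ := hP.variance_additive hQ Metric.isBounded_closedBall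
    measurableSet_closedBall (measurable_logCutoff R T) (logCutoff_nonneg R T)
    (logCutoff_le_one R T) (fun _ => logCutoff_eq_zero) e
  have h1 := hsNormSq_commutator_le hKQ hQ.isSelfAdjoint
    (boundedMeasurable_ofReal (measurable_logCutoff R T) (logCutoff_nonneg R T)
      (logCutoff_le_one R T)) (A := {x : ℝ | |x| ≤ R})
    (measurableSet_le measurable_norm measurable_const) e
  have h2 := cutoff_energy_inner_le hU hKQ.1 hR.le hRT hlocal hC
  have h3 := cutoff_energy_outer_le hU hα hα' hδ hC hR hRT hdecay
  have h4 : hsNormSq e (mulOp (volume.restrict U) _ (boundedMeasurable_ofReal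
      (measurable_logCutoff R T) (logCutoff_nonneg R T) (logCutoff_le_one R T)) ∘L Q -
        Q ∘L mulOp (volume.restrict U) _ (boundedMeasurable_ofReal (measurable_logCutoff R T)
          (logCutoff_nonneg R T) (logCutoff_le_one R T))) ≤
      ENNReal.ofReal (3 * (2 * (C / Real.log (T - R) ^ 2 * W.toReal) +
        2 * (2 * (k / Real.log (T - R) ^ 2 * m) * Real.log (T / R)))) := by
    refine h1.trans ?_
    rw [ENNReal.ofReal_mul (by norm_num), ENNReal.ofReal_add (by positivity) (by positivity),
      ENNReal.ofReal_mul (by norm_num), ENNReal.ofReal_mul (by positivity),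
      ENNReal.ofReal_toReal hW, ENNReal.ofReal_mul (p := 2) (by norm_num), ENNReal.ofReal_ofNat,
      ENNReal.ofReal_ofNat]
    gcongr
  have h5 := ENNReal.toReal_le_of_le_ofReal (by positivity) h4
  rw [← hvar] at h5
  have h6 : 3 * (2 * (C / Real.log (T - R) ^ 2 * W.toReal) +
        2 * (2 * (k / Real.log (T - R) ^ 2 * m) * Real.log (T / R))) =
      2 * ((3 * C * W.toReal + 6 * k * m * Real.log (T / R)) / Real.log (T - R) ^ 2) := by ring
  linarith

theorem isBigO_one_div_log {v : ℝ → ℝ} {c₁ c₂ R : ℝ} (hR : 0 < R) (hc₁ : 0 ≤ c₁) (hc₂ : 0 ≤ c₂)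
    (hv0 : ∀ T, 0 ≤ v T)
    (hv : ∀ T, R + 1 < T → v T ≤ (c₁ + c₂ * Real.log (T / R)) / Real.log (T - R) ^ 2) :
    v =O[atTop] fun T => 1 / Real.log T := by
  refine Asymptotics.IsBigO.of_bound (4 * (c₁ + 2 * c₂)) ?_
  filter_upwards [eventually_gt_atTop (R + 1), eventually_ge_atTop (2 * R),
    eventually_ge_atTop R⁻¹, eventually_ge_atTop 4, eventually_ge_atTop (Real.exp 1)]
    with T h1 h2 h3 h4 h5
  have hT : 0 < T := by linarith
  have hl : 1 ≤ Real.log T := (Real.le_log_iff_exp_le hT).2 h5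
  have hl0 : 0 < Real.log T := by linarith
  have h6 : Real.log T / 2 ≤ Real.log (T - R) := by
    -- T - R ≥ T/2 ≥ √T, from T ≥ 2R and T ≥ 4.
    rw [← Real.log_sqrt hT.le]
    refine Real.log_le_log (Real.sqrt_pos.2 hT) ?_
    have : Real.sqrt T ≤ T / 2 := by
      rw [Real.sqrt_le_left (by positivity)]
      nlinarith
    linarith
  have h7 : Real.log (T / R) ≤ 2 * Real.log T := by
    rw [Real.log_div hT.ne' hR.ne']
    have : Real.log R⁻¹ ≤ Real.log T := Real.log_le_log (by positivity) h3
    rw [Real.log_inv] at this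
    linarith
  rw [Real.norm_of_nonneg (hv0 T), Real.norm_of_nonneg (by positivity)]
  calc v T ≤ (c₁ + c₂ * Real.log (T / R)) / Real.log (T - R) ^ 2 := hv T h1
    _ ≤ (c₁ * Real.log T + c₂ * (2 * Real.log T)) / (Real.log T / 2) ^ 2 := by
        gcongr
        exact le_mul_of_one_le_right hc₁ hl
    _ = _ := by field_simp; ring

theorem isRigid_of_tendsto_variance [IsProbabilityMeasure P]
    (hmem : ∀ R, 0 < R → ∀ T, R < T → MemLp (additive (logCutoff R T)) 2 P)
    (hvar : ∀ R, 0 < R → Tendsto (fun T => variance (additive (logCutoff R T)) P) atTop (𝓝 0)) :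
    IsRigid P := by
  intro B hB hBm
  obtain ⟨R, hR, hBR⟩ := hB.subset_closedBall_lt 0 0
  -- Taking T > R + 1 makes the cutoff equal to 1 on `B`; the bounds 2⁻ⁿ make the variances
  -- summable.
  have hT : ∀ n : ℕ, ∃ T, R + 1 < T ∧ variance (additive (logCutoff R T)) P ≤ (1 / 2) ^ n :=
    fun n => ((eventually_gt_atTop (R + 1)).and
      ((hvar R hR).eventually_le_const (show (0 : ℝ) < (1 / 2) ^ n by positivity))).exists
  choose T hRT hv using hT
  have hlim := ae_tendsto_sub_integral_zero (fun n => hmem R hR (T n) (by linarith [hRT n])) hv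
  let g : ℕ → ℝ → ℝ := fun n => Bᶜ.indicator (logCutoff R (T n))
  have hg0 : ∀ n x, x ∉ Metric.closedBall (0 : ℝ) (T n) ∩ Bᶜ → g n x = 0 := by
    intro n x hx
    by_cases hxB : x ∈ Bᶜ
    · simp only [g, Set.indicator_of_mem hxB]
      exact logCutoff_eq_zero fun h => hx ⟨h, hxB⟩
    · exact Set.indicator_of_notMem hxB _
  have hgm : ∀ n, Measurable[countSigma Bᶜ] (additive (g n)) := fun n =>
    measurable_additive_countSigma
      (Metric.isBounded_closedBall.subset Set.inter_subset_left)
      (measurableSet_closedBall.inter hBm.compl) Set.inter_subset_right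
      ((measurable_logCutoff R (T n)).indicator hBm.compl)
      (fun x => Set.indicator_nonneg (fun x _ => logCutoff_nonneg R (T n) x) x)
      (fun x => Set.indicator_apply_le' (fun _ => logCutoff_le_one R (T n) x)
        (fun _ => zero_le_one)) (hg0 n)
  have hsplit : ∀ n X, additive (logCutoff R (T n)) X = count B X + additive (g n) X := by
    intro n X
    have h1 : B ⊆ Metric.closedBall 0 (T n) :=
      hBR.trans (Metric.closedBall_subset_closedBall (by linarith [hRT n]))
    rw [← additive_indicator_one X hB, ← additive_add X Metric.isBounded_closedBall
      (fun x hx => Set.indicator_of_notMem (fun h => hx (h1 h)) _)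
      (fun x hx => hg0 n x fun h => hx h.1)]
    congr 1
    ext x
    by_cases hx : x ∈ B
    · have h2 : |x| ≤ R := by simpa using hBR hx
      simp [g, hx, logCutoff_eq_one (show |x| ≤ R + 1 by linarith) (hRT n)]
    · simp [g, hx]
  refine measurable_eventuallyMeasurableSpace_of_tendsto (m := countSigma Bᶜ)
    (h := fun n X => (∫ Y, additive (logCutoff R (T n)) Y ∂P) - additive (g n) X)
    (fun n => (measurable_id.const_sub _).comp (hgm n)) ?_
  filter_upwards [hlim] with X hX
  have h := hX.const_sub (count B X : ℝ)
  rw [sub_zero] at h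
  refine h.congr fun n => ?_
  rw [hsplit]
  ring

end Main

end PointProcess

theorem mainTheorem4 (U : Set ℝ) (hU : IsOpen U)
    (K : ℝ → ℝ → ℂ)
    (Q : Lp ℂ 2 (volume.restrict U) →L[ℂ] Lp ℂ 2 (volume.restrict U))
    (hQ : IsStarProjection Q)
    (hKQ : PointProcess.IsKernelOf (volume.restrict U) K Q)
    (α ε : ℝ) (hα : 0 < α) (hα' : α < 1 / 2) (hε : 0 < ε)
    (C : ℝ → ℝ) (hC : ∀ R, 0 < R → 0 < C R)
    (hdecay : ∀ R, 0 < R → ∀ x ∈ U, ∀ y ∈ U, R ≤ |x| → R ≤ |y| → x ≠ y →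
      ‖K x y‖ ≤ C R * ((|x / y| ^ α + |y / x| ^ α) / |x - y|))
    (hlocal : ∀ R, 0 < R → ∀ y ∈ U,
      ∫⁻ x in {x : ℝ | |x| ≤ R}, ‖K x y‖ₑ ^ 2 ∂(volume.restrict U)
        ≤ ENNReal.ofReal (C R / (1 + |y| ^ (1 + ε))))
    (P : Measure (PointProcess.Configuration ℝ)) [IsProbabilityMeasure P]
    (hP : PointProcess.IsDeterminantal (volume.restrict U) Q P) :
    PointProcess.IsRigid P ∧
    ∀ R, 0 < R →
      (∀ T, R < T →
        MemLp (PointProcess.additive (PointProcess.logCutoff R T)) 2 P) ∧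
      (fun T : ℝ => variance (PointProcess.additive (PointProcess.logCutoff R T)) P)
        =O[atTop] (fun T : ℝ => 1 / Real.log T) := by
  have hmem : ∀ R T, MemLp (PointProcess.additive (PointProcess.logCutoff R T)) 2 P :=
    PointProcess.memLp_additive_logCutoff hQ hP
  have hvar : ∀ R, 0 < R → (fun T : ℝ => variance (PointProcess.additive
      (PointProcess.logCutoff R T)) P) =O[atTop] (fun T : ℝ => 1 / Real.log T) := by
    intro R hR
    obtain ⟨c₁, c₂, hc₁, hc₂, hv⟩ := PointProcess.exists_variance_logCutoff_le hU.measurableSet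
      hQ hKQ hP hα hα' hε (hC R hR).le hR (hdecay R hR) (hlocal R hR)
    exact PointProcess.isBigO_one_div_log hR hc₁ hc₂ (fun T => variance_nonneg _ _) hv
  refine ⟨PointProcess.isRigid_of_tendsto_variance (fun R _ T _ => hmem R T) fun R hR => ?_,
    fun R hR => ⟨fun T _ => hmem R T, hvar R hR⟩⟩
  refine (hvar R hR).trans_tendsto ?_
  exact Real.tendsto_log_atTop.inv_tendsto_atTop.congr fun T => (one_div _).symm
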